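/- Let $K$ be a field, let $P=\{p_1,\dots,p_n\}$ be a finite non-empty poset, let $1\le s\le r$ be integers, and let $S=K[x_{ij} : 1\le i\le r,\ 1\le j\le n]$ with the variables ordered by \[ x_{11}>x_{21}>\cdots>x_{r1}>x_{12}>\cdots>x_{r2}>\cdots>x_{1n}>\cdots>x_{rn}. \] Let $I_{r,s}(P)\subset S$ be the ideal generated by all monomials $\prod_{i\in A}x_{i j_i}$ with $p_{j_1}\le p_{j_2}\le\cdots\le p_{j_r}$ in $P$, $A\subseteq[r]$ and $|A|=s$. Let $H=H_{r,s}(P)=I_{r,s}(P)^\vee$ be its Alexander dual, i.e. the intersection of the prime ideals $(x_a : a\in F)$ over all squarefree monomials $\prod_{a\in F}x_a\in I_{r,s}(P)$. Let $G=G_{r,s}(P)$ be the set of minimal monomial generators of $H$. Let $L_{r,s}\subset R=K[y_u : u\in G]$ be the kernel of $R\to S$, $y_u\mapsto u$, and let $P_{\mathcal R(H)}\subset T=K[x_{ij},\,y_u]$ be the kernel of the map from $T$ onto the Rees algebra $\mathcal R(H)=\bigoplus_{k\ge0}H^kt^k\subset S[t]$ with $x_{ij}\mapsto x_{ij}$ and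 $y_u\mapsto ut$. For monomials $u,v\in G$, write $uv=z_1z_2\cdots z_{2d}$ with variables $z_1\ge z_2\ge\cdots\ge z_{2d}$ and put $\operatorname{sort}(u,v)=(z_1z_3\cdots z_{2d-1},\ z_2z_4\cdots z_{2d})$. Call $(u,v)$ unsorted if $\operatorname{sort}(u,v)\notin\{(u,v),(v,u)\}$. A monomial order $<^\sharp$ on $R$ is called a sorting order if $y_{u'}y_{v'}<^\sharp y_uy_v$ for all unsorted $(u,v)$ with $\operatorname{sort}(u,v)=(u',v')$ and $u',v'\in G$. Given a monomial order $<^\sharp$ on $R$, let $<^\sharp_{\mathrm{lex}}$ be the monomial order on $T$ that first compares the $x$-parts of two monomials by the lexicographic order induced by the above order of the variables, and, if these agree, compares the $y$-parts by $<^\sharp$. Then $G$ is sortable (all its elements have the same degree, and $\operatorname{sort}(u,v)\in G\times G$ for all $u,v\in G$), a sorting order exists, and for every sorting order $<^\sharp$ the following hold. (1) The reduced Gröbner basis $\mathcal G_{<^\sharp}(L_{r,s})$ of $L_{r,s}$ with respect to $<^\sharp$ consists of the sorting relations $y_uy_v-y_{u'}y_{v'}$ with $(u,v)$ unsorted and $(u',v')=\operatorname{sort}(u,v)$.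 (2) The reduced Gröbner basis of $P_{\mathcal R(H)}$ with respect to $<^\sharp_{\mathrm{lex}}$ consists of the elements of $\mathcal G_{<^\sharp}(L_{r,s})$ together with all binomials $x_ay_u-x_by_v$ ($u,v\in G$) such that $x_a>x_b$, $x_au=x_bv$, and $x_b$ is the smallest variable for which $x_au/x_b$ belongs to $H$. -/

import Mathlib

universe w

namespace GenHibi

noncomputable section

open MvPolynomial
open scoped MonomialOrder

/-! ### Gröbner bases -/

/-- The monomial order on the variables `σ ⊕ τ` that compares the `σ`-parts of two monomials
by `m₁` first and, if these agree, their `τ`-parts by `m₂`. -/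
def prodOrder {σ τ : Type*} (m₁ : MonomialOrder σ) (m₂ : MonomialOrder τ) :
    MonomialOrder (σ ⊕ τ) where
  syn := m₁.syn ×ₗ m₂.syn
  toSyn := Finsupp.sumFinsuppAddEquivProdFinsupp.trans
    ((m₁.toSyn.prodCongr m₂.toSyn).trans (toLexAddEquiv _))
  toSyn_monotone := by
    intro a b hab
    apply Prod.Lex.toLex_mono
    constructor
    · exact m₁.toSyn_monotone fun x => hab (Sum.inl x)
    · exact m₂.toSyn_monotone fun y => hab (Sum.inr y)

/-- The initial monomial of `f`. -/
def initialMonomial {σ K : Type*} [Field K] (m : MonomialOrder σ) (f : MvPolynomial σ K) :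
    MvPolynomial σ K :=
  monomial (m.degree f) 1

/-- The initial ideal of `I`. -/
def initialIdeal {σ K : Type*} [Field K] (m : MonomialOrder σ) (I : Ideal (MvPolynomial σ K)) :
    Ideal (MvPolynomial σ K) :=
  Ideal.span (initialMonomial m '' {f | f ∈ I ∧ f ≠ 0})

/-- `𝒢` is a Gröbner basis of `I` with respect to `m`. -/
structure IsGroebnerBasis {σ K : Type*} [Field K] (m : MonomialOrder σ)
    (I : Ideal (MvPolynomial σ K)) (𝒢 : Set (MvPolynomial σ K)) : Prop where
  finite : 𝒢.Finite
  subset : 𝒢 ⊆ I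
  zero_notMem : 0 ∉ 𝒢
  span_eq : Ideal.span (initialMonomial m '' 𝒢) = initialIdeal m I

/-- `𝒢` is the reduced Gröbner basis of `I` with respect to `m`: its elements have leading
coefficient `1`, and no monomial of one element is divisible by the initial monomial of another. -/
structure IsReducedGroebnerBasis {σ K : Type*} [Field K] (m : MonomialOrder σ)
    (I : Ideal (MvPolynomial σ K)) (𝒢 : Set (MvPolynomial σ K)) : Prop
    extends IsGroebnerBasis m I 𝒢 where
  monic : ∀ f ∈ 𝒢, m.Monic f
  reduced : ∀ f ∈ 𝒢, ∀ g ∈ 𝒢, f ≠ g → ∀ c ∈ g.support, ¬ m.degree f ≤ c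

/-! ### Monomial ideals -/

/-- The Alexander dual of a squarefree monomial ideal `I`: the intersection of the monomial primes
`(x_a : a ∈ F)`, where `F` ranges over the squarefree monomials `∏_{a ∈ F} x_a` in `I`. -/
def alexanderDual {σ K : Type*} [Field K] (I : Ideal (MvPolynomial σ K)) :
    Ideal (MvPolynomial σ K) :=
  ⨅ F : {F : Finset σ // ∏ a ∈ F, (X a : MvPolynomial σ K) ∈ I},
    Ideal.span ((X : σ → MvPolynomial σ K) '' (F.1 : Set σ))

/-- The exponent vectors of the minimal monomial generators of a monomial ideal `I`. -/
def minGens {σ K : Type*} [Field K] (I : Ideal (MvPolynomial σ K)) : Set (σ →₀ ℕ) :=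
  {u | monomial u 1 ∈ I ∧ ∀ w ≤ u, monomial w 1 ∈ I → w = u}

/-- The toric ideal of `K[x^u : u ∈ B]`: the kernel of `y_u ↦ x^u`. -/
def toricIdeal {σ : Type*} (K : Type*) [Field K] (B : Set (σ →₀ ℕ)) :
    Ideal (MvPolynomial B K) :=
  RingHom.ker (aeval fun u : B => (monomial u.1 1 : MvPolynomial σ K))

/-- The map `K[x_a, y_u] → ℛ(I) ⊆ S[t]`, `x_a ↦ x_a`, `y_u ↦ x^u t`, where `u` ranges over the
minimal monomial generators of `I`. -/
def reesMap {σ K : Type*} [Field K] (I : Ideal (MvPolynomial σ K)) :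
    MvPolynomial (σ ⊕ minGens I) K →ₐ[K] reesAlgebra I :=
  aeval (Sum.elim (fun a => algebraMap (MvPolynomial σ K) (reesAlgebra I) (X a))
    fun u => ⟨Polynomial.monomial 1 (monomial u.1 1),
      reesAlgebra.monomial_mem.2 (by simpa using u.2.1)⟩)

/-- The toric ideal of the Rees algebra of `I`. -/
def reesIdeal {σ K : Type*} [Field K] (I : Ideal (MvPolynomial σ K)) :
    Ideal (MvPolynomial (σ ⊕ minGens I) K) :=
  RingHom.ker (reesMap I)

/-! ### Sorting

A smaller element of `σ` is a larger variable: `x_a > x_b` if and only if `a < b`. -/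

/-- The letters of a word in odd positions (the first, third, …) and in even positions. -/
def alternate {α : Type*} : List α → List α × List α
  | [] => ([], [])
  | a :: l => (a :: (alternate l).2, (alternate l).1)

/-- The sorting operator: if `x^u x^v = x_{i_1} x_{i_2} ⋯` with `i_1 ≤ i_2 ≤ ⋯`, then
`sortPair u v` consists of the exponents of `x_{i_1} x_{i_3} ⋯` and `x_{i_2} x_{i_4} ⋯`. -/
def sortPair {σ : Type*} [LinearOrder σ] (u v : σ →₀ ℕ) : (σ →₀ ℕ) × (σ →₀ ℕ) :=
  let w := alternate ((Finsupp.toMultiset (u + v)).sort (· ≤ ·))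
  (Multiset.toFinsupp (w.1 : Multiset σ), Multiset.toFinsupp (w.2 : Multiset σ))

/-- A set of monomials of the same degree is sortable if it is closed under sorting. -/
def IsSortable {σ : Type*} [LinearOrder σ] (B : Set (σ →₀ ℕ)) : Prop :=
  (∃ d, ∀ u ∈ B, u.degree = d) ∧
    ∀ u ∈ B, ∀ v ∈ B, (sortPair u v).1 ∈ B ∧ (sortPair u v).2 ∈ B

/-- The pair is unsorted. Pairs which are sorted up to the order of their two entries are left
out as well, because for them the sorting relation `y_u y_v - y_v y_u` is zero. -/
def IsUnsorted {σ : Type*} [LinearOrder σ] (u v : σ →₀ ℕ) : Prop :=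
  sortPair u v ≠ (u, v) ∧ sortPair u v ≠ (v, u)

/-- The sorting relations `y_u y_v - y_{u'} y_{v'}` with `(u, v)` unsorted and
`(u', v') = sort(u, v)`. -/
def sortingRelations {σ : Type*} [LinearOrder σ] (K : Type*) [Field K] (B : Set (σ →₀ ℕ)) :
    Set (MvPolynomial B K) :=
  {f | ∃ u v u' v' : B, IsUnsorted u.1 v.1 ∧ sortPair u.1 v.1 = (u'.1, v'.1) ∧
    f = X u * X v - X u' * X v'}

/-- A sorting order: a monomial order for which the initial monomial of every sorting relation is
the product of the unsorted pair. -/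
def IsSortingOrder {σ : Type*} [LinearOrder σ] {B : Set (σ →₀ ℕ)} (m : MonomialOrder B) : Prop :=
  ∀ u v u' v' : B, IsUnsorted u.1 v.1 → sortPair u.1 v.1 = (u'.1, v'.1) →
    (Finsupp.single u' 1 + Finsupp.single v' 1) ≺[m] (Finsupp.single u 1 + Finsupp.single v 1)

/-- The binomials `x_a y_u - x_b y_v` with `x_a > x_b` and `x_a x^u = x_b x^v`, where `x_b` is the
smallest variable `x_c` for which `x_a x^u / x_c` belongs to `I`. -/
def linearRelations {σ K : Type*} [LinearOrder σ] [Field K] (I : Ideal (MvPolynomial σ K)) :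
    Set (MvPolynomial (σ ⊕ minGens I) K) :=
  {f | ∃ (a b : σ) (u v : minGens I), a < b ∧
    Finsupp.single a 1 + u.1 = Finsupp.single b 1 + v.1 ∧
    (∀ (c : σ) (w : σ →₀ ℕ), Finsupp.single c 1 + w = Finsupp.single a 1 + u.1 →
      monomial w 1 ∈ I → c ≤ b) ∧
    f = X (Sum.inl a) * X (Sum.inr u) - X (Sum.inl b) * X (Sum.inr v)}

/-! ### Generalized Hibi ideals -/

/-- The index set of the variables `x_{ij}`, `i ∈ [r]`, `j ∈ [n]`, with the linear order
`(1,1), (2,1), …, (r,1), (1,2), …, (r,2), …, (1,n), …, (r,n)`. -/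
abbrev Var (r n : ℕ) : Type := Fin n ×ₗ Fin r

/-- The index of the variable `x_{ij}`. -/
abbrev var {r n : ℕ} (i : Fin r) (j : Fin n) : Var r n := toLex (j, i)

/-- The multichain ideal `I_{r,s}(P)` of the poset `P = {p_1, …, p_n}`, where `p_j = p j`: it is
generated by the monomials `∏_{i ∈ A} x_{i j_i}` with `p_{j_1} ≤ ⋯ ≤ p_{j_r}`, `A ⊆ [r]` and
`|A| = s`. -/
def multichainIdeal {P : Type*} [PartialOrder P] (K : Type*) [Field K] (r s : ℕ) {n : ℕ}
    (p : Fin n ≃ P) : Ideal (MvPolynomial (Var r n) K) :=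
  Ideal.span {f | ∃ (j : Fin r → Fin n) (A : Finset (Fin r)),
    Monotone (fun i => p (j i)) ∧ A.card = s ∧ f = ∏ i ∈ A, X (var i (j i))}

/-- The generalized Hibi ideal `H_{r,s}(P)`. -/
def hibiIdeal {P : Type*} [PartialOrder P] (K : Type*) [Field K] (r s : ℕ) {n : ℕ}
    (p : Fin n ≃ P) : Ideal (MvPolynomial (Var r n) K) :=
  alexanderDual (multichainIdeal K r s p)

/-- The set `G_{r,s}(P)` of (exponents of) minimal monomial generators of `H_{r,s}(P)`. -/
abbrev hibiGens {P : Type*} [PartialOrder P] (K : Type*) [Field K] (r s : ℕ) {n : ℕ}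
    (p : Fin n ≃ P) : Set (Var r n →₀ ℕ) :=
  minGens (hibiIdeal K r s p)

/-- The order `<_lex^♯` on `K[x_{ij}, y_u]`: the lexicographic order on the `x`-part with
`x_{11} > x_{21} > ⋯ > x_{r1} > x_{12} > ⋯ > x_{rn}`, and ties broken by `<^♯` on the `y`-part. -/
abbrev lexSharp {r n : ℕ} {B : Set (Var r n →₀ ℕ)} (m : MonomialOrder B) :
    MonomialOrder (Var r n ⊕ B) :=
  prodOrder MonomialOrder.lex m

end

end GenHibi

/-!
A monomial `w` lies in `H_{r,s}(P)` iff its support meets every set `{(i, j_i) : i ∈ A}` with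
`|A| = s` that comes from a multichain. Such a `w` is divisible by the indicator monomial of a
family of sets `S_j ⊆ [r]` of size `t = r - s + 1` whose `k`-th smallest elements are isotone
functions of `p_j`; equivalently, the counting functions of the `S_j` decrease along `P`
(`IsotoneFamily`). The sets are read off from the numbers `minHits`, the least number of hits of a
multichain of length `k` that stays below `p_j`. These families have degree `n * t`, and they are
the minimal generators (`mem_hibiGens_iff`).

Everything about sorting is expressed by partial sums of exponents over initial segments of the
variables: sorting a pair replaces the two partial sums by the upper and lower half of their sum
(`sum_sortPair`). As the total number of letters in each column is even, the same holds for the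
prefixes of the columns, and isotone families are preserved. The degrees on intervals of variables
become as equal as possible, so the sum of their squares is a weight that decreases under sorting of
unsorted pairs, and refining this weight gives a sorting order (`exists_isSortingOrder`).

Both Gröbner bases are found by the same principle (`not_standard_degree`): it is enough that
nonstandard monomials can be made smaller without changing their image and that a standard monomial
is determined by its image. For the toric ideal of the generators this holds because the factors of
a pairwise sorted monomial can be ordered in such a way that the partial sums of the `k`-th factor
are `⌈(W - k) / N⌉` (with `k` counted from `0`), where `N` is the number of factors and `W` is the
partial sum of the product (`pre_getElem_of_pairwise_interlaced`).

For the Rees algebra an exchange property is needed. Consider two pairwise sorted monomials of the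
same degree with different images and choose `p_j` minimal in `P` such that the prefixes of their
images in column `j` differ. At the first place `i` where the prefix of one of them is smaller, the
formula above shows that, for some `a`, the `a`-th factor of this one has a smaller prefix than the
`a`-th factor of the other, while in the columns `j'` with `p_{j'} < p_j` they agree. So the next
letter of column `j` can be moved down to place `i` without leaving the set of isotone families
(`exchangeAt_of_colPre_lt`). If the two monomials are the `y`-parts of standard monomials with the
same image in the Rees algebra, then `x_{ij}` divides the `x`-part belonging to the first one, and
the exchange contradicts its being standard. The minimality in `P`, instead of minimality for the
order of the variables, makes the argument independent of the labelling of `P`.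
-/

namespace GenHibi

noncomputable section

open MvPolynomial
open scoped MonomialOrder

/-! ### Initial monomials and a criterion for Gröbner bases -/

theorem degree_eq_of_forall_le {σ K : Type*} [Field K] (m : MonomialOrder σ)
    {f : MvPolynomial σ K} {d : σ →₀ ℕ} (hd : coeff d f ≠ 0) (h : ∀ e ∈ f.support, e ≼[m] d) :
    m.degree f = d := by
  apply m.toSyn.injective
  apply le_antisymm
  · exact m.degree_le_iff.2 h
  · exact m.le_degree (mem_support_iff.2 hd)

theorem coeff_binomial_left {σ K : Type*} [Field K] {a b : σ →₀ ℕ} (h : a ≠ b) :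
    coeff a (monomial a 1 - monomial b 1 : MvPolynomial σ K) = 1 := by
  classical
  simp [coeff_monomial, h.symm]

theorem mem_support_binomial {σ K : Type*} [Field K] {a b e : σ →₀ ℕ}
    (he : e ∈ (monomial a 1 - monomial b 1 : MvPolynomial σ K).support) : e = a ∨ e = b := by
  classical
  by_contra! hne
  rw [mem_support_iff, coeff_sub, coeff_monomial, coeff_monomial, if_neg hne.1.symm,
    if_neg hne.2.symm] at he
  simp at he

theorem degree_binomial {σ K : Type*} [Field K] (m : MonomialOrder σ) {a b : σ →₀ ℕ}
    (h : b ≺[m] a) : m.degree (monomial a 1 - monomial b 1 : MvPolynomial σ K) = a := by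
  have hne : a ≠ b := fun e => by simp [e] at h
  apply degree_eq_of_forall_le
  · rw [coeff_binomial_left hne]; exact one_ne_zero
  · intro e he
    rcases mem_support_binomial he with rfl | rfl
    · exact le_rfl
    · exact h.le

theorem monic_binomial {σ K : Type*} [Field K] (m : MonomialOrder σ) {a b : σ →₀ ℕ}
    (h : b ≺[m] a) : m.Monic (monomial a 1 - monomial b 1 : MvPolynomial σ K) := by
  have hne : a ≠ b := fun e => by simp [e] at h
  rw [MonomialOrder.Monic, MonomialOrder.leadingCoeff, degree_binomial m h, coeff_binomial_left hne]

/-- A monomial lies in the ideal generated by the initial monomials of `𝒢` if and only if it is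
divisible by one of them. -/
theorem monomial_mem_span_initialMonomial {σ K : Type*} [Field K] (m : MonomialOrder σ)
    {𝒢 : Set (MvPolynomial σ K)} {d : σ →₀ ℕ} :
    monomial d (1 : K) ∈ Ideal.span (initialMonomial m '' 𝒢) ↔ ∃ g ∈ 𝒢, m.degree g ≤ d := by
  classical
  have : initialMonomial m '' 𝒢 = (fun s => monomial s (1 : K)) '' (m.degree '' 𝒢) := by
    rw [Set.image_image]; rfl
  rw [this, mem_ideal_span_monomial_image]
  simp [support_monomial]

/-- In an ideal annihilated by the functionals "sum of the coefficients over a fibre of `ψ`", every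
nonzero element has a second monomial in the fibre of its initial monomial. If every fibre contains
at most one standard monomial and every nonstandard monomial is larger than some other monomial
of its fibre, then initial monomials are therefore nonstandard. -/
theorem not_standard_degree {τ K M : Type*} [Field K] (m : MonomialOrder τ)
    {I : Ideal (MvPolynomial τ K)} (ψ : (τ →₀ ℕ) → M) (Std : (τ →₀ ℕ) → Prop)
    (hI : ∀ e : M, ∃ l : MvPolynomial τ K →ₗ[K] K, (∀ f ∈ I, l f = 0) ∧
      (∀ d, ψ d = e → l (monomial d 1) = 1) ∧ (∀ d, ψ d ≠ e → l (monomial d 1) = 0))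
    (huniq : ∀ d d', Std d → Std d' → ψ d = ψ d' → d = d')
    (hred : ∀ d, ¬ Std d → ∃ d', ψ d' = ψ d ∧ d' ≺[m] d)
    {f : MvPolynomial τ K} (hf : f ∈ I) (hf0 : f ≠ 0) : ¬ Std (m.degree f) := by
  intro hstd
  obtain ⟨l, hl0, hl1, hl2⟩ := hI (ψ (m.degree f))
  obtain ⟨d, hd, hψ, hne⟩ : ∃ d ∈ f.support, ψ d = ψ (m.degree f) ∧ d ≠ m.degree f := by
    by_contra! hcon
    have hsum : l f = coeff (m.degree f) f := by
      conv_lhs => rw [f.as_sum]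
      rw [map_sum, Finset.sum_eq_single (m.degree f)]
      · have : monomial (m.degree f) (coeff (m.degree f) f) =
            coeff (m.degree f) f • monomial (m.degree f) (1 : K) := by
          rw [smul_monomial, smul_eq_mul, mul_one]
        rw [this, map_smul, hl1 _ rfl, smul_eq_mul, mul_one]
      · intro b hb hb'
        have : monomial b (coeff b f) = coeff b f • monomial b (1 : K) := by
          rw [smul_monomial, smul_eq_mul, mul_one]
        rw [this, map_smul, hl2 b (fun h => hb' (hcon b hb h)), smul_zero]
      · intro h
        exact absurd (m.degree_mem_support hf0) h
    exact m.coeff_degree_ne_zero_iff.2 hf0 (hsum.symm.trans (hl0 f hf))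
  have hlt : d ≺[m] m.degree f :=
    lt_of_le_of_ne (m.le_degree hd) fun h => hne (m.toSyn.injective h)
  -- the smallest monomial of the fibre is standard, and smaller than the initial monomial
  obtain ⟨s, hs, hmin⟩ := WellFounded.has_min
    (InvImage.wf m.toSyn (wellFounded_lt (α := m.syn))) {d' | ψ d' = ψ (m.degree f)} ⟨d, hψ⟩
  have hs_std : Std s := by
    by_contra hns
    obtain ⟨d', h1, h2⟩ := hred s hns
    exact hmin d' (h1.trans hs) h2
  have hs_eq : s = m.degree f := huniq _ _ hs_std hstd hs
  exact hmin d hψ (hs_eq ▸ hlt)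

/-- A finite set of nonzero elements of `I` is a Gröbner basis if each initial monomial of `I` is
divisible by one of its initial monomials. -/
theorem isGroebnerBasis_of_exists_degree_le {τ K : Type*} [Field K] (m : MonomialOrder τ)
    {I : Ideal (MvPolynomial τ K)} {𝒢 : Set (MvPolynomial τ K)} (hfin : 𝒢.Finite)
    (hsub : 𝒢 ⊆ I) (h0 : 0 ∉ 𝒢)
    (h : ∀ f ∈ I, f ≠ 0 → ∃ g ∈ 𝒢, m.degree g ≤ m.degree f) : IsGroebnerBasis m I 𝒢 where
  finite := hfin
  subset := hsub
  zero_notMem := h0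
  span_eq := by
    apply le_antisymm
    · apply Ideal.span_mono
      apply Set.image_mono
      exact fun g hg => ⟨hsub hg, fun h => h0 (h ▸ hg)⟩
    · apply Ideal.span_le.2
      rintro _ ⟨f, ⟨hf, hf0⟩, rfl⟩
      exact (monomial_mem_span_initialMonomial m).2 (h f hf hf0)

/-! ### The product order -/

section ProdOrder

variable {σ τ : Type*}

/-- The exponent vector on `σ ⊕ τ` with given restrictions to `σ` and `τ`. -/
def joinExp (α : σ →₀ ℕ) (c : τ →₀ ℕ) : σ ⊕ τ →₀ ℕ :=
  Finsupp.sumFinsuppAddEquivProdFinsupp.symm (α, c)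

@[simp] theorem joinExp_inl (α : σ →₀ ℕ) (c : τ →₀ ℕ) (a : σ) : joinExp α c (Sum.inl a) = α a := by
  simp [joinExp]

@[simp] theorem joinExp_inr (α : σ →₀ ℕ) (c : τ →₀ ℕ) (u : τ) : joinExp α c (Sum.inr u) = c u := by
  simp [joinExp]

theorem exists_eq_joinExp (d : σ ⊕ τ →₀ ℕ) : ∃ α c, d = joinExp α c :=
  ⟨(Finsupp.sumFinsuppAddEquivProdFinsupp d).1, (Finsupp.sumFinsuppAddEquivProdFinsupp d).2,
    by simp [joinExp]⟩

theorem joinExp_le_iff {α α' : σ →₀ ℕ} {c c' : τ →₀ ℕ} :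
    joinExp α c ≤ joinExp α' c' ↔ α ≤ α' ∧ c ≤ c' := by
  constructor
  · intro h
    exact ⟨fun a => by simpa using h (Sum.inl a), fun a => by simpa using h (Sum.inr a)⟩
  · rintro ⟨h1, h2⟩ (a | a)
    · simpa using h1 a
    · simpa using h2 a

theorem mapDomain_inr_eq_joinExp (c : τ →₀ ℕ) : c.mapDomain Sum.inr = joinExp (0 : σ →₀ ℕ) c := by
  ext (a | a)
  · rw [Finsupp.mapDomain_of_notMem_range _ _ (by simp)]; simp
  · rw [Finsupp.mapDomain_apply Sum.inr_injective]; simp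

theorem joinExp_lt_iff {m₁ : MonomialOrder σ} {m₂ : MonomialOrder τ} {α α' : σ →₀ ℕ}
    {c c' : τ →₀ ℕ} : joinExp α c ≺[prodOrder m₁ m₂] joinExp α' c' ↔
      α ≺[m₁] α' ∨ α = α' ∧ c ≺[m₂] c' := by
  change toLex (Prod.map m₁.toSyn m₂.toSyn (Finsupp.sumFinsuppAddEquivProdFinsupp (joinExp α c))) <
    toLex (Prod.map m₁.toSyn m₂.toSyn (Finsupp.sumFinsuppAddEquivProdFinsupp (joinExp α' c'))) ↔ _
  rw [Prod.Lex.toLex_lt_toLex]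
  simp [joinExp]

theorem joinExp_toSyn_le_iff_right {m₁ : MonomialOrder σ} {m₂ : MonomialOrder τ} {α : σ →₀ ℕ}
    {c c' : τ →₀ ℕ} : joinExp α c ≼[prodOrder m₁ m₂] joinExp α c' ↔ c ≼[m₂] c' := by
  rw [← not_lt, ← not_lt, joinExp_lt_iff]
  simp

theorem X_mul_X_eq_monomial (K : Type*) [Field K] (a : σ) (u : τ) :
    (X (Sum.inl a) * X (Sum.inr u) : MvPolynomial (σ ⊕ τ) K) =
      monomial (joinExp (Finsupp.single a 1) (Finsupp.single u 1)) 1 := by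
  classical
  have h : (Finsupp.single (Sum.inl a) 1 + Finsupp.single (Sum.inr u) 1 : σ ⊕ τ →₀ ℕ) =
      joinExp (Finsupp.single a 1) (Finsupp.single u 1) := by
    ext (b | b) <;> simp [Finsupp.single_apply]
  rw [X, X, monomial_mul, one_mul, h]

theorem degree_rename_inr {K : Type*} [Field K] (m₁ : MonomialOrder σ) (m₂ : MonomialOrder τ)
    (g : MvPolynomial τ K) :
    (prodOrder m₁ m₂).degree (rename Sum.inr g) = joinExp 0 (m₂.degree g) := by
  rcases eq_or_ne g 0 with rfl | hg
  · simp [joinExp]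
  apply degree_eq_of_forall_le
  · rw [← mapDomain_inr_eq_joinExp, coeff_rename_mapDomain _ Sum.inr_injective]
    exact m₂.coeff_degree_ne_zero_iff.2 hg
  · intro e he
    classical
    rw [support_rename_of_injective Sum.inr_injective, Finset.mem_image] at he
    obtain ⟨d, hd, rfl⟩ := he
    rw [mapDomain_inr_eq_joinExp, joinExp_toSyn_le_iff_right]
    exact m₂.le_degree hd

theorem monic_rename_inr {K : Type*} [Field K] (m₁ : MonomialOrder σ) (m₂ : MonomialOrder τ)
    {g : MvPolynomial τ K} (hg : m₂.Monic g) : (prodOrder m₁ m₂).Monic (rename Sum.inr g) := by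
  rw [MonomialOrder.Monic, MonomialOrder.leadingCoeff, degree_rename_inr,
    ← mapDomain_inr_eq_joinExp, coeff_rename_mapDomain _ Sum.inr_injective]
  exact hg

end ProdOrder

/-! ### Monomial orders refining a weight -/

/-- The weight of an exponent vector, followed by its image under `m`. -/
def weightHom {τ : Type*} (m : MonomialOrder τ) (w : τ → ℕ) : (τ →₀ ℕ) →+ ℕ ×ₗ m.syn where
  toFun d := toLex (Finsupp.weight w d, m.toSyn d)
  map_zero' := by rw [map_zero, map_zero]; rfl
  map_add' a b := by rw [map_add, map_add]; rfl

theorem weightHom_injective {τ : Type*} (m : MonomialOrder τ) (w : τ → ℕ) :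
    Function.Injective (weightHom m w) := fun _ _ h =>
  m.toSyn.injective (congrArg Prod.snd (toLex.injective h))

/-- `weightHom` as an equivalence onto its image. -/
def weightEquiv {τ : Type*} (m : MonomialOrder τ) (w : τ → ℕ) :
    (τ →₀ ℕ) ≃+ AddMonoidHom.mrange (weightHom m w) :=
  AddEquiv.ofBijective (weightHom m w).mrangeRestrict
    ⟨fun _ _ h => weightHom_injective m w (congrArg Subtype.val h),
      (weightHom m w).mrangeRestrict_surjective⟩

/-- The monomial order that compares monomials by their weight first and, if the weights agree,
by `m`. Its synonym type is the image of the exponent vectors in `ℕ ×ₗ m.syn`. -/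
def weightOrder {τ : Type*} (m : MonomialOrder τ) (w : τ → ℕ) : MonomialOrder τ where
  syn := AddMonoidHom.mrange (weightHom m w)
  toSyn := weightEquiv m w
  toSyn_monotone a b hab := by
    change toLex (Finsupp.weight w a, m.toSyn a) ≤ toLex (Finsupp.weight w b, m.toSyn b)
    apply Prod.Lex.toLex_mono
    refine ⟨?_, m.toSyn_monotone hab⟩
    obtain ⟨c, rfl⟩ := le_iff_exists_add.1 hab
    simp

theorem weightOrder_lt_of_weight_lt {τ : Type*} (m : MonomialOrder τ) (w : τ → ℕ) {a b : τ →₀ ℕ}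
    (h : Finsupp.weight w a < Finsupp.weight w b) : a ≺[weightOrder m w] b := by
  change toLex (Finsupp.weight w a, m.toSyn a) < toLex (Finsupp.weight w b, m.toSyn b)
  exact Prod.Lex.toLex_lt_toLex.2 (Or.inl h)

theorem nonempty_monomialOrder (τ : Type) [Finite τ] : Nonempty (MonomialOrder.{0, 0} τ) := by
  classical
  let : LinearOrder τ := linearOrderOfSTO WellOrderingRel
  exact ⟨MonomialOrder.lex⟩

/-! ### Partial sums and the sorting operator -/

theorem sq_add_sq_le_of_balanced {a b a' b' : ℕ} (h : a' + b' = a + b) (h1 : b' ≤ a' + 1)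
    (h2 : a' ≤ b' + 1) : a' ^ 2 + b' ^ 2 ≤ a ^ 2 + b ^ 2 := by
  have h3 : a' = b' ∨ b' = a' + 1 ∨ a' = b' + 1 := by omega
  rcases le_total a b with hab | hab <;> obtain ⟨e, rfl⟩ := Nat.exists_eq_add_of_le hab
  all_goals
    have h4 : (e = 0 ∨ 1 ≤ e) := by omega
    rcases h3 with rfl | rfl | rfl <;> rcases h4 with rfl | h4 <;> zify at * <;> nlinarith

theorem sq_add_sq_lt_of_balanced {a b a' b' : ℕ} (h : a' + b' = a + b) (h1 : b' ≤ a' + 1)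
    (h2 : a' ≤ b' + 1) (hab : a + 2 ≤ b ∨ b + 2 ≤ a) : a' ^ 2 + b' ^ 2 < a ^ 2 + b ^ 2 := by
  have h3 : a' = b' ∨ b' = a' + 1 ∨ a' = b' + 1 := by omega
  rcases hab with hab | hab <;> obtain ⟨e, rfl⟩ := Nat.exists_eq_add_of_le hab <;>
    rcases h3 with rfl | rfl | rfl <;> zify at * <;> nlinarith

section Sorting

variable {σ : Type*} [LinearOrder σ]

theorem countP_alternate (p : σ → Prop) [DecidablePred p] (hp : ∀ a b, a ≤ b → p b → p a) :
    ∀ l : List σ, l.Pairwise (· ≤ ·) →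
      (alternate l).1.countP (fun a => decide (p a)) =
        (l.countP (fun a => decide (p a)) + 1) / 2 ∧
      (alternate l).2.countP (fun a => decide (p a)) = l.countP (fun a => decide (p a)) / 2
  | [], _ => by simp [alternate]
  | a :: l, h => by
    obtain ⟨ha, hl⟩ := List.pairwise_cons.1 h
    obtain ⟨h1, h2⟩ := countP_alternate p hp l hl
    simp only [alternate, List.countP_cons, h1, h2]
    by_cases hpa : p a
    · simp only [hpa, decide_true, reduceIte]
      exact ⟨by omega, trivial⟩
    · have h0 : l.countP (fun a => decide (p a)) = 0 := by
        rw [List.countP_eq_zero]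
        intro b hb
        simpa using fun hpb => hpa (hp a b (ha b hb) hpb)
      simp [hpa, h0]

theorem sortPair_comm (u v : σ →₀ ℕ) : sortPair u v = sortPair v u := by
  rw [sortPair, sortPair, add_comm]

variable [Fintype σ]

theorem sum_toFinsupp_eq_countP (p : σ → Prop) [DecidablePred p] (s : Multiset σ) :
    ∑ y with p y, Multiset.toFinsupp s y = s.countP p := by
  induction s using Multiset.induction_on with
  | empty => simp
  | cons a s ih =>
    simp only [Multiset.toFinsupp_apply] at ih ⊢
    rw [Multiset.countP_cons, ← ih]
    simp [Multiset.count_cons, Finset.sum_add_distrib]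

/-- Sorting halves every sum over an initial segment of the variables, because the letters from an
initial segment form an initial segment of the sorted word. -/
theorem sum_sortPair (u v : σ →₀ ℕ) (p : σ → Prop) [DecidablePred p]
    (hp : ∀ a b, a ≤ b → p b → p a) :
    ∑ y with p y, (sortPair u v).1 y = (∑ y with p y, u y + ∑ y with p y, v y + 1) / 2 ∧
    ∑ y with p y, (sortPair u v).2 y = (∑ y with p y, u y + ∑ y with p y, v y) / 2 := by
  have hs := countP_alternate p hp ((Finsupp.toMultiset (u + v)).sort (· ≤ ·))
    (Multiset.pairwise_sort _ _)
  have hc : ((Finsupp.toMultiset (u + v)).sort (· ≤ ·)).countP (fun a => decide (p a)) =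
      ∑ y with p y, u y + ∑ y with p y, v y := by
    rw [← Multiset.coe_countP, Multiset.sort_eq, ← sum_toFinsupp_eq_countP,
      Finsupp.toMultiset_toFinsupp, ← Finset.sum_add_distrib]
    rfl
  rw [hc] at hs
  simp only [sortPair]
  rw [sum_toFinsupp_eq_countP, sum_toFinsupp_eq_countP, Multiset.coe_countP, Multiset.coe_countP]
  exact hs

/-- The partial sum of the exponents of `u` over the variables `y ≤ x`. -/
def pre (u : σ →₀ ℕ) (x : σ) : ℕ := ∑ y with y ≤ x, u y

theorem pre_add (u v : σ →₀ ℕ) (x : σ) : pre (u + v) x = pre u x + pre v x := by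
  simp [pre, Finset.sum_add_distrib]

@[simp] theorem pre_zero (x : σ) : pre (0 : σ →₀ ℕ) x = 0 := by simp [pre]

theorem pre_mono (u : σ →₀ ℕ) : Monotone (pre u) := fun x y h =>
  Finset.sum_le_sum_of_subset fun z hz => by simp at hz ⊢; exact hz.trans h

theorem pre_injective {u v : σ →₀ ℕ} (h : ∀ x, pre u x = pre v x) : u = v := by
  ext x
  induction x using WellFoundedLT.induction with
  | ind x ih =>
    have hx : ∀ w : σ →₀ ℕ, pre w x = w x + ∑ y with y < x, w y := fun w => by
      rw [pre, ← Finset.sum_insert (by simp)]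
      congr 1
      ext y; simp [le_iff_eq_or_lt]
    have hs : ∑ y with y < x, u y = ∑ y with y < x, v y :=
      Finset.sum_congr rfl fun y hy => ih y (by simpa using hy)
    have := h x
    rw [hx, hx, hs] at this
    omega

theorem pre_sortPair_fst (u v : σ →₀ ℕ) (x : σ) :
    pre (sortPair u v).1 x = (pre u x + pre v x + 1) / 2 :=
  (sum_sortPair u v (· ≤ x) fun _ _ h h' => h.trans h').1

theorem pre_sortPair_snd (u v : σ →₀ ℕ) (x : σ) :
    pre (sortPair u v).2 x = (pre u x + pre v x) / 2 :=
  (sum_sortPair u v (· ≤ x) fun _ _ h h' => h.trans h').2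

theorem sortPair_add (u v : σ →₀ ℕ) : (sortPair u v).1 + (sortPair u v).2 = u + v := by
  apply pre_injective
  intro x
  rw [pre_add, pre_add, pre_sortPair_fst, pre_sortPair_snd]
  omega

/-- `u` and `v` interlace if the partial sums of `u` exceed those of `v` by `0` or `1`, that is,
if `(u, v)` is a sorted pair. -/
def Interlaced (u v : σ →₀ ℕ) : Prop := ∀ x, pre v x ≤ pre u x ∧ pre u x ≤ pre v x + 1

theorem sortPair_eq_iff (u v : σ →₀ ℕ) : sortPair u v = (u, v) ↔ Interlaced u v := by
  constructor
  · intro h x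
    have h1 := pre_sortPair_fst u v x
    have h2 := pre_sortPair_snd u v x
    rw [h] at h1 h2
    simp only at h1 h2
    omega
  · intro h
    ext1
    · apply pre_injective
      intro x
      have := h x
      change _ = pre u x
      rw [pre_sortPair_fst]
      omega
    · apply pre_injective
      intro x
      have := h x
      change _ = pre v x
      rw [pre_sortPair_snd]
      omega

theorem not_isUnsorted_iff (u v : σ →₀ ℕ) :
    ¬ IsUnsorted u v ↔ Interlaced u v ∨ Interlaced v u := by
  rw [IsUnsorted, ← sortPair_eq_iff, ← sortPair_eq_iff, sortPair_comm v u]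
  tauto

theorem interlaced_sortPair (u v : σ →₀ ℕ) : Interlaced (sortPair u v).1 (sortPair u v).2 := by
  intro x
  rw [pre_sortPair_fst, pre_sortPair_snd]
  omega

theorem IsUnsorted.ne {u v : σ →₀ ℕ} (h : IsUnsorted u v) : u ≠ v := by
  rintro rfl
  exact (not_isUnsorted_iff u u).2 (Or.inl fun x => ⟨le_rfl, Nat.le_succ _⟩) h

/-! ### A sorting order -/

/-- The sum of the squares of the degrees of `u` on all intervals of variables. Sorting makes these
degrees as equal as possible, so the sum of the weights of an unsorted pair drops under sorting. -/
def sortWeight (u : σ →₀ ℕ) : ℕ :=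
  ∑ x, pre u x ^ 2 + ∑ z : σ × σ, (pre u z.2 - pre u z.1) ^ 2

theorem sortWeight_lt {u v : σ →₀ ℕ} (h : IsUnsorted u v) :
    sortWeight (sortPair u v).1 + sortWeight (sortPair u v).2 < sortWeight u + sortWeight v := by
  have e1 := pre_sortPair_fst u v
  have e2 := pre_sortPair_snd u v
  have hA : ∀ x, pre (sortPair u v).1 x ^ 2 + pre (sortPair u v).2 x ^ 2 ≤
      pre u x ^ 2 + pre v x ^ 2 := fun x => by
    apply sq_add_sq_le_of_balanced <;> rw [e1, e2] <;> omega
  have hB : ∀ z : σ × σ, (pre (sortPair u v).1 z.2 - pre (sortPair u v).1 z.1) ^ 2 +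
      (pre (sortPair u v).2 z.2 - pre (sortPair u v).2 z.1) ^ 2 ≤
      (pre u z.2 - pre u z.1) ^ 2 + (pre v z.2 - pre v z.1) ^ 2 := fun z => by
    rcases le_total z.1 z.2 with hz | hz
    · have hu := pre_mono u hz
      have hv := pre_mono v hz
      apply sq_add_sq_le_of_balanced <;> rw [e1, e2, e1, e2] <;> omega
    · have h1 := pre_mono (sortPair u v).1 hz
      have h2 := pre_mono (sortPair u v).2 hz
      rw [Nat.sub_eq_zero_of_le h1, Nat.sub_eq_zero_of_le h2]
      simp
  have hrw : ∀ a b : σ →₀ ℕ, sortWeight a + sortWeight b =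
      ∑ x, (pre a x ^ 2 + pre b x ^ 2) +
      ∑ z : σ × σ, ((pre a z.2 - pre a z.1) ^ 2 + (pre b z.2 - pre b z.1) ^ 2) := fun a b => by
    rw [sortWeight, sortWeight, Finset.sum_add_distrib, Finset.sum_add_distrib]
    omega
  rw [hrw, hrw]
  by_cases hfar : ∃ x, pre u x + 2 ≤ pre v x ∨ pre v x + 2 ≤ pre u x
  · obtain ⟨x, hx⟩ := hfar
    refine add_lt_add_of_lt_of_le (Finset.sum_lt_sum (fun x _ => hA x) ⟨x, Finset.mem_univ _, ?_⟩)
      (Finset.sum_le_sum fun z _ => hB z)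
    apply sq_add_sq_lt_of_balanced _ _ _ hx <;> rw [e1, e2] <;> omega
  · push Not at hfar
    have hns : ¬ (Interlaced u v ∨ Interlaced v u) := fun hcon =>
      (not_isUnsorted_iff u v).2 hcon h
    rw [not_or, Interlaced, Interlaced] at hns
    push Not at hns
    -- the partial sums of `u` are smaller somewhere and larger elsewhere, hence the degrees on the
    -- interval in between differ by two
    obtain ⟨⟨x, hx⟩, y, hy⟩ := hns
    have hfx := hfar x
    have hfy := hfar y
    have hx' : pre v x = pre u x + 1 := by
      by_contra hcon
      have := hx (by omega)
      omega
    have hy' : pre u y = pre v y + 1 := by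
      by_contra hcon
      have := hy (by omega)
      omega
    refine add_lt_add_of_le_of_lt (Finset.sum_le_sum fun x _ => hA x)
      (Finset.sum_lt_sum (fun z _ => hB z) ?_)
    rcases le_total x y with hxy | hxy
    · refine ⟨(x, y), Finset.mem_univ _, ?_⟩
      have hu := pre_mono u hxy
      have hv := pre_mono v hxy
      apply sq_add_sq_lt_of_balanced <;> simp only [e1, e2] <;> omega
    · refine ⟨(y, x), Finset.mem_univ _, ?_⟩
      have hu := pre_mono u hxy
      have hv := pre_mono v hxy
      apply sq_add_sq_lt_of_balanced <;> simp only [e1, e2] <;> omega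

end Sorting

theorem exists_isSortingOrder {σ : Type} [LinearOrder σ] [Fintype σ] {B : Set (σ →₀ ℕ)}
    (hB : B.Finite) : ∃ m : MonomialOrder.{0, 0} B, IsSortingOrder m := by
  have : Finite B := hB
  obtain ⟨m⟩ := nonempty_monomialOrder B
  refine ⟨weightOrder m fun u => sortWeight u.1, fun u v u' v' h h' => ?_⟩
  apply weightOrder_lt_of_weight_lt
  have := sortWeight_lt h
  rw [h'] at this
  simpa [Finsupp.weight_single] using this

/-! ### The toric ideal of a sortable set of monomials -/

section Toric

variable {σ : Type*}

/-- The exponent vector of the image `∏ x^u` of the monomial `∏ y_u`. -/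
def total (B : Set (σ →₀ ℕ)) : (B →₀ ℕ) →+ (σ →₀ ℕ) :=
  (Finsupp.linearCombination ℕ (Subtype.val : B → σ →₀ ℕ)).toAddMonoidHom

@[simp] theorem total_single {B : Set (σ →₀ ℕ)} (u : B) : total B (Finsupp.single u 1) = u.1 := by
  simp [total]

theorem total_eq_sum_map {B : Set (σ →₀ ℕ)} (c : B →₀ ℕ) {l : List B}
    (hl : Finsupp.toMultiset c = l) : total B c = (l.map Subtype.val).sum := by
  classical
  have h : ∀ l : List B, total B (Multiset.toFinsupp (l : Multiset B)) =
      (l.map Subtype.val).sum := by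
    intro l
    induction l with
    | nil => simp
    | cons a l ih =>
      rw [← Multiset.cons_coe, ← Multiset.singleton_add, map_add, map_add, ih]
      simp
  rw [← h, ← hl, Finsupp.toMultiset_toFinsupp]

theorem degree_total {B : Set (σ →₀ ℕ)} {d : ℕ} (hd : ∀ u ∈ B, u.degree = d) (c : B →₀ ℕ) :
    (total B c).degree = d * c.degree := by
  induction c using Finsupp.induction_linear with
  | zero => simp
  | add f g hf hg => simp [hf, hg, mul_add]
  | single u k =>
    have : Finsupp.single u k = k • Finsupp.single u 1 := by simp
    rw [this, map_nsmul, total_single, map_nsmul, map_nsmul, hd _ u.2]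
    simp [mul_comm]

theorem aeval_monomial_eq (K : Type*) [Field K] {B : Set (σ →₀ ℕ)} (c : B →₀ ℕ) :
    aeval (fun u : B => (monomial u.1 1 : MvPolynomial σ K)) (monomial c (1 : K)) =
      monomial (total B c) 1 := by
  induction c using Finsupp.induction_linear with
  | zero => simp
  | add f g hf hg =>
    have hmul : (monomial (f + g) 1 : MvPolynomial B K) = monomial f 1 * monomial g 1 := by
      rw [monomial_mul, one_mul]
    rw [hmul, map_mul, hf, hg, monomial_mul, one_mul, map_add]
  | single u k =>
    have : Finsupp.single u k = k • Finsupp.single u 1 := by simp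
    have hX : (monomial (k • Finsupp.single u 1) 1 : MvPolynomial B K) = X u ^ k := by
      rw [X, monomial_pow, one_pow]
    rw [this, map_nsmul, total_single, hX, map_pow, aeval_X, monomial_pow, one_pow]

theorem binomial_mem_toricIdeal (K : Type*) [Field K] {B : Set (σ →₀ ℕ)} {c c' : B →₀ ℕ}
    (h : total B c = total B c') :
    (monomial c 1 - monomial c' 1 : MvPolynomial B K) ∈ toricIdeal K B := by
  rw [toricIdeal, RingHom.mem_ker, map_sub]
  exact (sub_eq_zero.2 (by rw [aeval_monomial_eq, aeval_monomial_eq, h]))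

theorem exists_fiber_functional_toricIdeal (K : Type*) [Field K] (B : Set (σ →₀ ℕ)) (e : σ →₀ ℕ) :
    ∃ l : MvPolynomial B K →ₗ[K] K, (∀ f ∈ toricIdeal K B, l f = 0) ∧
      (∀ c, total B c = e → l (monomial c 1) = 1) ∧
      (∀ c, total B c ≠ e → l (monomial c 1) = 0) := by
  classical
  refine ⟨lcoeff K e ∘ₗ
    (aeval fun u : B => (monomial u.1 1 : MvPolynomial σ K)).toLinearMap, ?_, ?_, ?_⟩
  · intro f hf
    rw [toricIdeal, RingHom.mem_ker] at hf
    change coeff e (aeval (fun u : B => (monomial u.1 1 : MvPolynomial σ K)) f) = 0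
    rw [show aeval (fun u : B => (monomial u.1 1 : MvPolynomial σ K)) f = 0 from hf, coeff_zero]
  · intro c hc
    change coeff e (aeval _ _) = 1
    rw [aeval_monomial_eq, coeff_monomial, if_pos hc]
  · intro c hc
    change coeff e (aeval _ _) = 0
    rw [aeval_monomial_eq, coeff_monomial, if_neg hc]

end Toric

theorem eq_of_le_of_degree_eq {τ : Type*} {a b : τ →₀ ℕ} (h : a ≤ b) (hd : a.degree = b.degree) :
    a = b := by
  obtain ⟨c, rfl⟩ := le_iff_exists_add.1 h
  have : c.degree = 0 := by rw [map_add] at hd; omega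
  rw [(Finsupp.degree_eq_zero_iff c).1 this, add_zero]

theorem single_add_single_le {τ : Type*} {u v : τ} (huv : u ≠ v) {c : τ →₀ ℕ}
    (hu : u ∈ c.support) (hv : v ∈ c.support) :
    Finsupp.single u 1 + Finsupp.single v 1 ≤ c := by
  classical
  intro x
  have h1 := Finsupp.mem_support_iff.1 hu
  have h2 := Finsupp.mem_support_iff.1 hv
  simp only [Finsupp.add_apply, Finsupp.single_apply]
  split_ifs with ha hb hb
  · exact absurd (ha.trans hb.symm) huv
  · subst ha; omega
  · subst hb; omega
  · omega

theorem single_add_single_eq_iff {τ : Type*} {u v u' v' : τ} :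
    (Finsupp.single u 1 + Finsupp.single v 1 : τ →₀ ℕ) =
      Finsupp.single u' 1 + Finsupp.single v' 1 ↔ (u = u' ∧ v = v') ∨ (u = v' ∧ v = u') := by
  rw [Finsupp.single_add_single_eq_single_add_single one_ne_zero one_ne_zero]
  simp

theorem X_mul_X_sub_eq (K : Type*) [Field K] {τ : Type*} (u v u' v' : τ) :
    (X u * X v - X u' * X v' : MvPolynomial τ K) =
      monomial (Finsupp.single u 1 + Finsupp.single v 1) 1 -
        monomial (Finsupp.single u' 1 + Finsupp.single v' 1) 1 := by
  simp [X, monomial_mul]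

section Sortable

variable {σ : Type*} [LinearOrder σ]

/-- A monomial `∏ y_u` is pairwise sorted if no two of its variables form an unsorted pair. -/
def PairwiseSorted {B : Set (σ →₀ ℕ)} (c : B →₀ ℕ) : Prop :=
  ∀ u ∈ c.support, ∀ v ∈ c.support, ¬ IsUnsorted u.1 v.1

variable [Fintype σ]

/-- The factors of a pairwise sorted monomial can be arranged such that each of them interlaces with
all later ones. -/
theorem PairwiseSorted.exists_list {B : Set (σ →₀ ℕ)} {c : B →₀ ℕ} (hc : PairwiseSorted c) :
    ∃ l : List B, Finsupp.toMultiset c = l ∧ l.Pairwise fun u v => Interlaced u.1 v.1 := by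
  let s : B → ℕ := fun u => ∑ x, pre u.1 x
  let le : B → B → Bool := fun u v => decide (s v ≤ s u)
  let l := (Finsupp.toMultiset c).toList.mergeSort le
  have hl : Finsupp.toMultiset c = (l : Multiset B) := by
    rw [Multiset.coe_eq_coe.2 (List.mergeSort_perm _ le), Multiset.coe_toList]
  refine ⟨l, hl, ?_⟩
  have hmem : ∀ u ∈ l, u ∈ c.support := fun u hu => by
    rw [← Finsupp.mem_toMultiset, hl]; exact hu
  refine (List.pairwise_mergeSort (le := le) (fun a b d h1 h2 => ?_) (fun a b => ?_) _).imp_of_mem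
    fun {u v} hu hv huv => ?_
  · simp only [le, decide_eq_true_eq] at *
    exact h2.trans h1
  · simpa [le] using le_total _ _
  · rcases (not_isUnsorted_iff u.1 v.1).1 (hc u (hmem u hu) v (hmem v hv)) with h | h
    · exact h
    · have hle : s v ≤ s u := by simpa [le] using huv
      have heq := (Finset.sum_eq_sum_iff_of_le fun x _ => (h x).1).1
        (le_antisymm (Finset.sum_le_sum fun x _ => (h x).1) hle)
      intro x
      have := heq x (Finset.mem_univ x)
      omega

/-- If `a 0 ≥ a 1 ≥ ⋯ ≥ a 0 - 1`, then the entries of `a` are determined by their sum. -/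
theorem eq_sum_div_of_balanced {N : ℕ} (a : Fin N → ℕ)
    (h : ∀ i j, i < j → a j ≤ a i ∧ a i ≤ a j + 1) (k : Fin N) :
    a k = (∑ i, a i + (N - 1 - k)) / N := by
  have hk := k.2
  have h1 : N * a k ≤ ∑ i, a i + (N - 1 - k) := by
    have hsum : ∑ i : Fin N, (if k < i then 1 else 0) = N - 1 - (k : ℕ) := by
      rw [Finset.sum_boole, Nat.cast_id]
      have : Finset.univ.filter (fun i => k < i) = Finset.Ioi k := by ext; simp
      rw [this, Fin.card_Ioi]
    rw [← hsum, ← Finset.sum_add_distrib]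
    calc N * a k = ∑ _i : Fin N, a k := by simp
      _ ≤ _ := Finset.sum_le_sum fun i _ => by
        split_ifs with hi
        · exact (h k i hi).2
        · rcases (not_lt.1 hi).lt_or_eq with hi | rfl
          · simpa using (h i k hi).1
          · simp
  have h2 : ∑ i, a i ≤ N * a k + k := by
    have hsum : ∑ i : Fin N, (if i < k then 1 else 0) = (k : ℕ) := by
      rw [Finset.sum_boole, Nat.cast_id]
      have : Finset.univ.filter (fun i => i < k) = Finset.Iio k := by ext; simp
      rw [this, Fin.card_Iio]
    calc ∑ i, a i ≤ ∑ i : Fin N, (a k + if i < k then 1 else 0) := Finset.sum_le_sum fun i _ => by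
          split_ifs with hi
          · exact (h i k hi).2
          · rcases (not_lt.1 hi).lt_or_eq with hi | rfl
            · simpa using (h k i hi).1
            · simp
      _ = _ := by rw [Finset.sum_add_distrib, hsum]; simp
  symm
  rw [Nat.div_eq_iff (by omega)]
  rw [mul_comm] at h1 h2
  omega

theorem sum_pre_getElem {B : Set (σ →₀ ℕ)} {c : B →₀ ℕ} {l : List B}
    (hl : Finsupp.toMultiset c = l) (x : σ) :
    ∑ i : Fin l.length, pre l[i].1 x = pre (total B c) x := by
  rw [total_eq_sum_map c hl]
  have : ∀ l' : List B, pre ((l'.map Subtype.val).sum) x =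
      (l'.map fun u => pre u.1 x).sum := fun l' => by
    induction l' with
    | nil => simp
    | cons a l' ih =>
      rw [List.map_cons, List.sum_cons, pre_add, ih, List.map_cons, List.sum_cons]
  rw [this, ← Fin.sum_univ_fun_getElem]
  rfl

/-- The partial sums of the `k`-th factor of a pairwise sorted monomial are determined by those of
the product, and they are monotone functions of the latter. -/
theorem pre_getElem_of_pairwise_interlaced {B : Set (σ →₀ ℕ)} {c : B →₀ ℕ} {l : List B}
    (hl : Finsupp.toMultiset c = l) (hp : l.Pairwise fun u v => Interlaced u.1 v.1)
    (k : ℕ) (hk : k < l.length) (x : σ) :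
    pre l[k].1 x = (pre (total B c) x + (l.length - 1 - k)) / l.length := by
  have h := eq_sum_div_of_balanced (fun i : Fin l.length => pre l[i].1 x)
    (fun i j hij => (List.pairwise_iff_getElem.1 hp i j i.2 j.2 hij) x) ⟨k, hk⟩
  rw [sum_pre_getElem hl] at h
  exact h

theorem length_of_toMultiset_eq {τ : Type*} {c : τ →₀ ℕ} {l : List τ}
    (hl : Finsupp.toMultiset c = l) : l.length = c.degree := by
  rw [← Multiset.coe_card, ← hl, Finsupp.card_toMultiset, Finsupp.degree]
  rfl

/-- A pairwise sorted monomial is determined by its degree and its image. -/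
theorem PairwiseSorted.eq_of_total_eq {B : Set (σ →₀ ℕ)} {c c' : B →₀ ℕ} (hc : PairwiseSorted c)
    (hc' : PairwiseSorted c') (hdeg : c.degree = c'.degree) (h : total B c = total B c') :
    c = c' := by
  obtain ⟨l, hl, hp⟩ := hc.exists_list
  obtain ⟨l', hl', hp'⟩ := hc'.exists_list
  have hlen : l.length = l'.length := by
    rw [length_of_toMultiset_eq hl, length_of_toMultiset_eq hl', hdeg]
  have : l = l' := List.ext_getElem hlen fun k h1 h2 => Subtype.ext <| pre_injective fun x => by
    rw [pre_getElem_of_pairwise_interlaced hl hp, pre_getElem_of_pairwise_interlaced hl' hp', h,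
      hlen]
  classical
  apply Multiset.toFinsupp.symm.injective
  change Finsupp.toMultiset c = Finsupp.toMultiset c'
  rw [hl, hl', this]

/-- A monomial which is not pairwise sorted has a smaller monomial with the same image. -/
theorem exists_lt_of_not_pairwiseSorted {B : Set (σ →₀ ℕ)} (hB : IsSortable B)
    {m : MonomialOrder B} (hm : IsSortingOrder m) {c : B →₀ ℕ} (hc : ¬ PairwiseSorted c) :
    ∃ c', total B c' = total B c ∧ c'.degree = c.degree ∧ c' ≺[m] c := by
  rw [PairwiseSorted] at hc
  push Not at hc
  obtain ⟨u, hu, v, hv, huv⟩ := hc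
  obtain ⟨e, rfl⟩ := le_iff_exists_add.1
    (single_add_single_le (fun h => huv.ne (congrArg Subtype.val h)) hu hv)
  have hs := hB.2 u.1 u.2 v.1 v.2
  refine ⟨Finsupp.single ⟨_, hs.1⟩ 1 + Finsupp.single ⟨_, hs.2⟩ 1 + e, ?_, ?_, ?_⟩
  · simp only [map_add, total_single, sortPair_add]
  · simp
  · rw [map_add, map_add m.toSyn _ e]
    exact add_lt_add_left (hm u v ⟨_, hs.1⟩ ⟨_, hs.2⟩ huv rfl) _

theorem exists_sortingRelation_degree_le (K : Type*) [Field K] {B : Set (σ →₀ ℕ)}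
    (hB : IsSortable B) {m : MonomialOrder B} (hm : IsSortingOrder m) {c : B →₀ ℕ}
    (hc : ¬ PairwiseSorted c) : ∃ g ∈ sortingRelations K B, m.degree g ≤ c := by
  rw [PairwiseSorted] at hc
  push Not at hc
  obtain ⟨u, hu, v, hv, huv⟩ := hc
  have hs := hB.2 u.1 u.2 v.1 v.2
  refine ⟨_, ⟨u, v, ⟨_, hs.1⟩, ⟨_, hs.2⟩, huv, rfl, rfl⟩, ?_⟩
  rw [X_mul_X_sub_eq, degree_binomial m (hm u v ⟨_, hs.1⟩ ⟨_, hs.2⟩ huv rfl)]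
  exact single_add_single_le (fun h => huv.ne (congrArg Subtype.val h)) hu hv

/-- The sorting relations of a finite sortable set of monomials of positive degree form the reduced
Gröbner basis of its toric ideal. -/
theorem isReducedGroebnerBasis_sortingRelations (K : Type*) [Field K] {B : Set (σ →₀ ℕ)}
    (hfin : B.Finite) (hB : IsSortable B) {d : ℕ} (hd0 : 0 < d) (hd : ∀ u ∈ B, u.degree = d)
    {m : MonomialOrder B} (hm : IsSortingOrder m) :
    IsReducedGroebnerBasis m (toricIdeal K B) (sortingRelations K B) := by
  have : Finite B := hfin
  have hdeg : ∀ c c' : B →₀ ℕ, total B c = total B c' → c.degree = c'.degree := fun c c' h => by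
    have := congrArg Finsupp.degree h
    rw [degree_total hd, degree_total hd] at this
    exact Nat.eq_of_mul_eq_mul_left hd0 this
  refine ⟨isGroebnerBasis_of_exists_degree_le m ?_ ?_ ?_ ?_, ?_, ?_⟩
  · refine (Set.finite_range fun q : B × B × B × B =>
      (X q.1 * X q.2.1 - X q.2.2.1 * X q.2.2.2 : MvPolynomial B K)).subset ?_
    rintro _ ⟨u, v, u', v', -, -, rfl⟩
    exact ⟨(u, v, u', v'), rfl⟩
  · rintro _ ⟨u, v, u', v', -, h, rfl⟩
    rw [X_mul_X_sub_eq]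
    apply binomial_mem_toricIdeal
    have := sortPair_add u.1 v.1
    rw [h] at this
    simpa using this.symm
  · rintro ⟨u, v, u', v', hu, h, h0⟩
    have := monic_binomial (K := K) m (hm u v u' v' hu h)
    rw [← X_mul_X_sub_eq, ← h0] at this
    exact this.ne_zero rfl
  · intro f hf hf0
    apply exists_sortingRelation_degree_le K hB hm
    exact not_standard_degree m (total B) PairwiseSorted
      (exists_fiber_functional_toricIdeal K B)
      (fun c c' hc hc' h => hc.eq_of_total_eq hc' (hdeg c c' h) h)
      (fun c hc => by
        obtain ⟨c', h1, -, h2⟩ := exists_lt_of_not_pairwiseSorted hB hm hc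
        exact ⟨c', h1, h2⟩) hf hf0
  · rintro _ ⟨u, v, u', v', hu, h, rfl⟩
    rw [X_mul_X_sub_eq]
    exact monic_binomial m (hm u v u' v' hu h)
  · rintro _ ⟨u, v, u', v', hu, h, rfl⟩ _ ⟨a, b, a', b', ha, h', rfl⟩ hne c hc hle
    rw [X_mul_X_sub_eq] at hc hle
    rw [degree_binomial m (hm u v u' v' hu h)] at hle
    rcases mem_support_binomial hc with rfl | rfl
    -- the sorting relation is determined by the initial monomial
    · have := eq_of_le_of_degree_eq hle (by simp)
      rw [single_add_single_eq_iff] at this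
      apply hne
      rcases this with ⟨rfl, rfl⟩ | ⟨rfl, rfl⟩
      · rw [h, Prod.mk.injEq] at h'
        rw [Subtype.ext h'.1, Subtype.ext h'.2]
      · rw [sortPair_comm, h, Prod.mk.injEq] at h'
        rw [Subtype.ext h'.1, Subtype.ext h'.2, mul_comm (X u)]
    -- the other monomial of a sorting relation is sorted
    · have := eq_of_le_of_degree_eq hle (by simp)
      rw [single_add_single_eq_iff] at this
      have hi := interlaced_sortPair a.1 b.1
      rw [h'] at hi
      rcases this with ⟨rfl, rfl⟩ | ⟨rfl, rfl⟩
      · exact (not_isUnsorted_iff _ _).2 (Or.inl hi) hu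
      · exact (not_isUnsorted_iff _ _).2 (Or.inr hi) hu

end Sortable

/-! ### The generators of generalized Hibi ideals -/

section Columns

variable {r n : ℕ}

/-- The sum of the first `k` exponents of `u` in column `j`. -/
def colPre (u : Var r n →₀ ℕ) (j : Fin n) (k : ℕ) : ℕ := ∑ i : Fin r with i.val < k, u (var i j)

@[simp] theorem colPre_zero (u : Var r n →₀ ℕ) (j : Fin n) : colPre u j 0 = 0 := by simp [colPre]

theorem colPre_succ (u : Var r n →₀ ℕ) (j : Fin n) (i : Fin r) :
    colPre u j (i + 1) = colPre u j i + u (var i j) := by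
  rw [colPre, colPre, add_comm (Finset.sum _ _),
    ← Finset.sum_insert (f := fun i => u (var i j)) (by simp)]
  congr 1
  ext a
  simp [Fin.ext_iff]
  omega

theorem colPre_of_le (u : Var r n →₀ ℕ) (j : Fin n) {k : ℕ} (hk : r ≤ k) :
    colPre u j k = colPre u j r := by
  rw [colPre, colPre]
  congr 1
  ext a
  simp [a.2.trans_le hk]

theorem colPre_eq_sum (u : Var r n →₀ ℕ) (j : Fin n) :
    colPre u j r = ∑ i : Fin r, u (var i j) := by
  rw [colPre]
  congr 1
  ext a
  simp

theorem colPre_mono (u : Var r n →₀ ℕ) (j : Fin n) : Monotone (colPre u j) := fun k l h =>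
  Finset.sum_le_sum_of_subset fun i hi => by simp at hi ⊢; omega

theorem colPre_add (u v : Var r n →₀ ℕ) (j : Fin n) (k : ℕ) :
    colPre (u + v) j k = colPre u j k + colPre v j k := by
  simp [colPre, Finset.sum_add_distrib]

theorem eq_of_colPre_eq {u v : Var r n →₀ ℕ} (h : ∀ j k, colPre u j k = colPre v j k) : u = v := by
  ext x
  obtain ⟨⟨j, i⟩, rfl⟩ := toLex.surjective x
  have h1 := colPre_succ u j i
  have h2 := colPre_succ v j i
  rw [h, h] at h1
  change u (var i j) = v (var i j)
  omega

theorem sum_var (f : Var r n → ℕ) : ∑ x, f x = ∑ j : Fin n, ∑ i : Fin r, f (var i j) := by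
  rw [← Fintype.sum_prod_type']
  exact (Equiv.sum_comp toLex f).symm

theorem degree_eq_sum_colPre (u : Var r n →₀ ℕ) : u.degree = ∑ j, colPre u j r := by
  rw [Finsupp.degree_eq_sum, sum_var]
  simp_rw [colPre_eq_sum]

/-- The variable `y` is one of the variables of the columns before column `j` or one of the first
`k` variables of column `j`. -/
def IsBefore (j : Fin n) (k : ℕ) (y : Var r n) : Prop :=
  (ofLex y).1 < j ∨ (ofLex y).1 = j ∧ ((ofLex y).2 : ℕ) < k

instance (j : Fin n) (k : ℕ) : DecidablePred (IsBefore (r := r) j k) := fun y => by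
  unfold IsBefore; infer_instance

theorem IsBefore.of_le {j : Fin n} {k : ℕ} {a b : Var r n} (hab : a ≤ b) (hb : IsBefore j k b) :
    IsBefore j k a := by
  rw [Prod.Lex.le_iff] at hab
  rcases hab with h | ⟨h, h'⟩
  · rcases hb with h1 | ⟨rfl, -⟩
    · exact Or.inl (h.trans h1)
    · exact Or.inl h
  · rcases hb with h1 | ⟨h1, h2⟩
    · exact Or.inl (h ▸ h1)
    · exact Or.inr ⟨h.trans h1, lt_of_le_of_lt h' h2⟩

theorem sum_isBefore (u : Var r n →₀ ℕ) (j : Fin n) (k : ℕ) :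
    ∑ y with IsBefore j k y, u y = ∑ j' with j' < j, colPre u j' r + colPre u j k := by
  have h : ∀ j' : Fin n, ∑ i : Fin r, (if IsBefore j k (var i j') then u (var i j') else 0) =
      (if j' < j then colPre u j' r else 0) + if j' = j then colPre u j k else 0 := by
    intro j'
    rcases lt_trichotomy j' j with hj | rfl | hj
    · simp [IsBefore, hj, hj.ne, colPre_eq_sum]
    · simp [IsBefore, colPre, Finset.sum_filter]
    · simp [IsBefore, hj.not_gt, hj.ne']
  rw [Finset.sum_filter, sum_var]
  simp_rw [h]
  rw [Finset.sum_add_distrib, Finset.sum_filter]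
  simp

theorem pre_var (u : Var r n →₀ ℕ) (i : Fin r) (j : Fin n) :
    pre u (var i j) = ∑ j' with j' < j, colPre u j' r + colPre u j (i + 1) := by
  rw [← sum_isBefore, pre]
  congr 1
  ext y
  simp only [Finset.mem_filter, Finset.mem_univ, true_and, Prod.Lex.le_iff, IsBefore, ofLex_toLex,
    Nat.lt_succ_iff, Fin.le_def]

end Columns

section Families

variable {P : Type*} [PartialOrder P] {r n : ℕ}

/-- `u` is the indicator function of a family of `t`-element subsets `S_j ⊆ [r]` such that, for each
`k`, the `k`-th smallest element of `S_j` is an isotone function of `p_j`. The last condition is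
expressed by the counting functions of the sets `S_j`. -/
structure IsotoneFamily (p : Fin n ≃ P) (t : ℕ) (u : Var r n →₀ ℕ) : Prop where
  le_one : ∀ x, u x ≤ 1
  col_sum : ∀ j, colPre u j r = t
  anti : ∀ j j', p j ≤ p j' → ∀ k, colPre u j' k ≤ colPre u j k

/-- The support of `w` meets each of the sets `{(i, j_i) : i ∈ A}` whose monomials generate the
multichain ideal. -/
def IsCover (p : Fin n ≃ P) (s : ℕ) (w : Var r n →₀ ℕ) : Prop :=
  ∀ j : Fin r → Fin n, Monotone (fun i => p (j i)) → ∀ A : Finset (Fin r), A.card = s →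
    ∃ i ∈ A, w (var i (j i)) ≠ 0

theorem monomial_mem_hibiIdeal_iff (K : Type*) [Field K] (s : ℕ) (p : Fin n ≃ P)
    (w : Var r n →₀ ℕ) : monomial w (1 : K) ∈ hibiIdeal K r s p ↔ IsCover p s w := by
  classical
  have hprod : ∀ {ι : Type} (A : Finset ι) (f : ι → Var r n),
      (∏ i ∈ A, X (f i) : MvPolynomial (Var r n) K) =
        monomial (∑ i ∈ A, Finsupp.single (f i) 1) 1 := fun A f => by
    rw [monomial_sum_one]; rfl
  have hX : ∀ F : Finset (Var r n), monomial w (1 : K) ∈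
      Ideal.span ((X : Var r n → MvPolynomial (Var r n) K) '' (F : Set (Var r n))) ↔
      ∃ a ∈ F, w a ≠ 0 := fun F => by
    rw [mem_ideal_span_X_image]
    simp [support_monomial]
  rw [hibiIdeal, alexanderDual, Ideal.mem_iInf]
  simp only [hX]
  constructor
  · intro h j hj A hA
    have hmem : ∏ a ∈ A.image (fun i => var i (j i)), (X a : MvPolynomial (Var r n) K) ∈
        multichainIdeal K r s p := by
      rw [Finset.prod_image (fun a _ b _ hab => (Prod.ext_iff.1 (toLex.injective hab)).2)]
      exact Ideal.subset_span ⟨j, A, hj, hA, rfl⟩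
    obtain ⟨a, ha, hw⟩ := h ⟨_, hmem⟩
    obtain ⟨i, hi, rfl⟩ := Finset.mem_image.1 ha
    exact ⟨i, hi, hw⟩
  · rintro h ⟨F, hF⟩
    have hgen : {f : MvPolynomial (Var r n) K | ∃ (j : Fin r → Fin n) (A : Finset (Fin r)),
        Monotone (fun i => p (j i)) ∧ A.card = s ∧ f = ∏ i ∈ A, X (var i (j i))} =
        (fun e => monomial e (1 : K)) '' {e | ∃ (j : Fin r → Fin n) (A : Finset (Fin r)),
          Monotone (fun i => p (j i)) ∧ A.card = s ∧
            e = ∑ i ∈ A, Finsupp.single (var i (j i)) 1} := by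
      ext f
      constructor
      · rintro ⟨j, A, hj, hA, rfl⟩
        exact ⟨_, ⟨j, A, hj, hA, rfl⟩, (hprod A _).symm⟩
      · rintro ⟨_, ⟨j, A, hj, hA, rfl⟩, rfl⟩
        exact ⟨j, A, hj, hA, (hprod A _).symm⟩
    rw [multichainIdeal, hgen, hprod F fun a => a, mem_ideal_span_monomial_image] at hF
    obtain ⟨_, ⟨j, A, hj, hA, rfl⟩, hle⟩ := hF (∑ a ∈ F, Finsupp.single a 1)
      (by simp [support_monomial])
    obtain ⟨i, hi, hw⟩ := h j hj A hA
    refine ⟨var i (j i), ?_, hw⟩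
    by_contra hnot
    have h1 := hle (var i (j i))
    rw [Finsupp.finsetSum_apply, Finsupp.finsetSum_apply] at h1
    have h2 : ∑ a ∈ F, (Finsupp.single a 1 : Var r n →₀ ℕ) (var i (j i)) = 0 :=
      Finset.sum_eq_zero fun a ha => by
        rw [Finsupp.single_apply, if_neg]
        rintro rfl
        exact hnot ha
    have h3 := Finset.single_le_sum
      (f := fun a => (Finsupp.single (var a (j a)) 1 : Var r n →₀ ℕ) (var i (j i)))
      (fun a _ => Nat.zero_le _) hi
    simp only [Finsupp.single_eq_same] at h3
    omega

/-- Along a multichain `j`, the counting function of `S_{j_i}` on `[1, i]` grows only at those `i`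
that lie in `S_{j_i}`. So at least `t` of the `i` do. -/
theorem IsotoneFamily.isCover {p : Fin n ≃ P} {s t : ℕ} (hs : 1 ≤ s) (hst : s + t = r + 1)
    {u : Var r n →₀ ℕ} (hu : IsotoneFamily p t u) : IsCover p s u := by
  intro j hj A hA
  by_contra! hcon
  have hcount : ∀ k (hk : k < r), colPre u (j ⟨k, hk⟩) (k + 1) ≤
      ∑ i : Fin r with i.val < k + 1, u (var i (j i)) := by
    intro k
    induction k with
    | zero =>
      intro hk
      rw [colPre]
      refine Finset.sum_le_sum fun i hi => le_of_eq ?_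
      have : i = ⟨0, hk⟩ := by simp at hi; exact Fin.ext hi
      rw [this]
    | succ k ih =>
      intro hk
      have h1 := ih (by omega)
      have h2 := colPre_succ u (j ⟨k + 1, hk⟩) ⟨k + 1, hk⟩
      have h3 := hu.anti (j ⟨k, by omega⟩) (j ⟨k + 1, hk⟩) (hj (by simp [Fin.le_def])) (k + 1)
      have h4 : ∑ i : Fin r with i.val < k + 1 + 1, u (var i (j i)) =
          u (var ⟨k + 1, hk⟩ (j ⟨k + 1, hk⟩)) +
            ∑ i : Fin r with i.val < k + 1, u (var i (j i)) := by
        rw [← Finset.sum_insert (f := fun i => u (var i (j i))) (by simp)]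
        congr 1
        ext a
        simp [Fin.ext_iff]
        omega
      rw [h4, h2]
      simp only at *
      omega
  have hsr : A.card ≤ r := by simpa using A.card_le_univ
  have hr : 0 < r := by omega
  have h1 := hcount (r - 1) (by omega)
  rw [Nat.sub_add_cancel hr, hu.col_sum] at h1
  have h2 : ∑ i : Fin r with i.val < r, u (var i (j i)) = ∑ i ∈ Aᶜ, u (var i (j i)) := by
    symm
    apply Finset.sum_subset
    · intro i; simp
    · intro i _ hi
      exact hcon i (by simpa using hi)
  have h3 : ∑ i ∈ Aᶜ, u (var i (j i)) ≤ Aᶜ.card := by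
    rw [Finset.card_eq_sum_ones]
    exact Finset.sum_le_sum fun i _ => hu.le_one _
  rw [Finset.card_compl, Fintype.card_fin] at h3
  omega

/-- `1` if `w` is divisible by the `k`-th variable (counted from `0`) of column `j`, otherwise
`0`. -/
def hit (w : Var r n →₀ ℕ) (j : Fin n) (k : ℕ) : ℕ :=
  if h : k < r then min (w (var ⟨k, h⟩ j)) 1 else 0

open Classical in
/-- The least number of the variables `x_{1 j_1}, …, x_{k j_k}` dividing `w`, where
`p_{j_1} ≤ ⋯ ≤ p_{j_k} ≤ p_j`. -/
def minHits (p : Fin n ≃ P) (w : Var r n →₀ ℕ) : ℕ → Fin n → ℕ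
  | 0, _ => 0
  | k + 1, j => (Finset.univ.filter fun j' => p j' ≤ p j).inf' ⟨j, by simp⟩
      fun j' => minHits p w k j' + hit w j' k

theorem minHits_succ_le (p : Fin n ≃ P) (w : Var r n →₀ ℕ) (k : ℕ) {j j' : Fin n}
    (h : p j' ≤ p j) : minHits p w (k + 1) j ≤ minHits p w k j' + hit w j' k := by
  rw [minHits]
  exact Finset.inf'_le (fun j' => minHits p w k j' + hit w j' k) (by simpa using h)

theorem exists_minHits_succ_eq (p : Fin n ≃ P) (w : Var r n →₀ ℕ) (k : ℕ) (j : Fin n) :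
    ∃ j', p j' ≤ p j ∧ minHits p w (k + 1) j = minHits p w k j' + hit w j' k := by
  classical
  obtain ⟨j', hj', h⟩ := Finset.exists_mem_eq_inf' (s := Finset.univ.filter fun j' => p j' ≤ p j)
    ⟨j, by simp⟩ fun j' => minHits p w k j' + hit w j' k
  refine ⟨j', by simpa using hj', ?_⟩
  rw [minHits, ← h]

theorem minHits_anti (p : Fin n ≃ P) (w : Var r n →₀ ℕ) (k : ℕ) {j j' : Fin n}
    (h : p j ≤ p j') : minHits p w k j' ≤ minHits p w k j := by
  cases k with
  | zero => simp [minHits]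
  | succ k =>
    obtain ⟨i, hi, he⟩ := exists_minHits_succ_eq p w k j
    rw [he]
    exact minHits_succ_le p w k (hi.trans h)

theorem minHits_le_succ (p : Fin n ≃ P) (w : Var r n →₀ ℕ) (k : ℕ) (j : Fin n) :
    minHits p w k j ≤ minHits p w (k + 1) j := by
  obtain ⟨i, hi, he⟩ := exists_minHits_succ_eq p w k j
  have := minHits_anti p w k hi
  omega

theorem exists_multichain_minHits_eq (p : Fin n ≃ P) (w : Var r n →₀ ℕ) (k : ℕ) (j : Fin n) :
    ∃ g : ℕ → Fin n, (∀ a b, a ≤ b → p (g a) ≤ p (g b)) ∧ (∀ a, p (g a) ≤ p j) ∧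
      minHits p w k j = ∑ a ∈ Finset.range k, hit w (g a) a := by
  induction k generalizing j with
  | zero => exact ⟨fun _ => j, fun _ _ _ => le_rfl, fun _ => le_rfl, by simp [minHits]⟩
  | succ k ih =>
    obtain ⟨j', hj', he⟩ := exists_minHits_succ_eq p w k j
    obtain ⟨g, hg, hgj, hs⟩ := ih j'
    refine ⟨fun a => if a < k then g a else j', fun a b hab => ?_, fun a => ?_, ?_⟩
    · by_cases hb : b < k
      · simpa [hb, lt_of_le_of_lt hab hb] using hg a b hab
      · by_cases ha : a < k
        · simpa [hb, ha] using hgj a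
        · simp [hb, ha]
    · by_cases ha : a < k
      · simpa [ha] using (hgj a).trans hj'
      · simpa [ha] using hj'
    · rw [he, hs, Finset.sum_range_succ]
      simp only [lt_irrefl, if_false]
      congr 1
      exact Finset.sum_congr rfl fun a ha => by simp [Finset.mem_range.1 ha]

theorem IsCover.le_minHits {p : Fin n ≃ P} {s t : ℕ} (hst : s + t = r + 1)
    {w : Var r n →₀ ℕ} (hw : IsCover p s w) (j : Fin n) : t ≤ minHits p w r j := by
  obtain ⟨g, hg, -, hs⟩ := exists_multichain_minHits_eq p w r j
  by_contra! hlt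
  -- a multichain with fewer than `t` hits misses `w` at `s` or more places
  have hs' : minHits p w r j = (Finset.univ.filter fun i : Fin r => w (var i (g i)) ≠ 0).card := by
    rw [hs, Finset.card_filter, ← Fin.sum_univ_eq_sum_range (fun a => hit w (g a) a)]
    refine Finset.sum_congr rfl fun i _ => ?_
    have hi : hit w (g i) i = min (w (var i (g i))) 1 := by simp [hit]
    rw [hi]
    split_ifs <;> omega
  have hcard := Finset.card_filter_add_card_filter_not (s := (Finset.univ : Finset (Fin r)))
    (fun i => w (var i (g i)) ≠ 0)
  rw [Finset.card_univ, Fintype.card_fin, ← hs'] at hcard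
  obtain ⟨A, hA, hAs⟩ := Finset.exists_subset_card_eq
    (s := Finset.univ.filter fun i : Fin r => ¬ w (var i (g i)) ≠ 0) (n := s) (by omega)
  obtain ⟨i, hi, hne⟩ := hw (fun i => g i) (fun a b hab => hg a b hab) A hAs
  have := hA hi
  simp [hne] at this

/-- Every cover contains an isotone family: the set `S_j` consists of the first `t` places where
`minHits` jumps. -/
theorem IsCover.exists_isotoneFamily_le {p : Fin n ≃ P} {s t : ℕ} (hst : s + t = r + 1)
    {w : Var r n →₀ ℕ} (hw : IsCover p s w) : ∃ u ≤ w, IsotoneFamily p t u := by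
  let N := minHits p w
  let u : Var r n →₀ ℕ := Finsupp.equivFunOnFinite.symm fun x =>
    min (N ((ofLex x).2 + 1) (ofLex x).1) t - min (N (ofLex x).2 (ofLex x).1) t
  have hu : ∀ i j, u (var i j) = min (N (i + 1) j) t - min (N i j) t := fun i j => rfl
  have hmono : ∀ k j, N k j ≤ N (k + 1) j := minHits_le_succ p w
  have hstep : ∀ k j, N (k + 1) j ≤ N k j + hit w j k := fun k j =>
    minHits_succ_le p w k le_rfl
  have hhit : ∀ (i : Fin r) j, hit w j i = min (w (var i j)) 1 := fun i j => by
    simp [hit]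
  have hcol : ∀ j k, k ≤ r → colPre u j k = min (N k j) t := by
    intro j k
    induction k with
    | zero => intro _; simp [N, minHits]
    | succ k ih =>
      intro hk
      have h1 := colPre_succ u j ⟨k, hk⟩
      have h2 := hmono k j
      rw [hu] at h1
      simp only at h1
      rw [h1, ih (by omega)]
      omega
  refine ⟨u, fun x => ?_, fun x => ?_, fun j => ?_, fun j j' h k => ?_⟩
  · obtain ⟨⟨j, i⟩, rfl⟩ := toLex.surjective x
    change u (var i j) ≤ w (var i j)
    have h1 := hstep i j
    rw [hhit] at h1
    rw [hu]
    omega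
  · obtain ⟨⟨j, i⟩, rfl⟩ := toLex.surjective x
    change u (var i j) ≤ 1
    have h1 := hstep i j
    rw [hhit] at h1
    rw [hu]
    omega
  · rw [hcol j r le_rfl]
    exact min_eq_right (hw.le_minHits hst j)
  · rcases le_total k r with hk | hk
    · rw [hcol _ _ hk, hcol _ _ hk]
      exact min_le_min_right _ (minHits_anti p w k h)
    · rw [colPre_of_le _ _ hk, colPre_of_le _ _ hk, hcol _ _ le_rfl, hcol _ _ le_rfl]
      exact min_le_min_right _ (minHits_anti p w r h)

theorem IsotoneFamily.degree_eq {p : Fin n ≃ P} {t : ℕ} {u : Var r n →₀ ℕ}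
    (hu : IsotoneFamily p t u) : u.degree = n * t := by
  rw [degree_eq_sum_colPre]
  simp [hu.col_sum]

/-- The minimal generators of `H_{r,s}(P)` are the isotone families of sets of size
`t = r - s + 1`. -/
theorem mem_hibiGens_iff (K : Type*) [Field K] {s t : ℕ} (hs : 1 ≤ s) (hst : s + t = r + 1)
    (p : Fin n ≃ P) (u : Var r n →₀ ℕ) : u ∈ hibiGens K r s p ↔ IsotoneFamily p t u := by
  simp only [minGens, Set.mem_ofPred_eq, monomial_mem_hibiIdeal_iff]
  constructor
  · rintro ⟨h1, h2⟩
    obtain ⟨v, hv, hv'⟩ := h1.exists_isotoneFamily_le hst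
    rw [← h2 v hv (hv'.isCover hs hst)]
    exact hv'
  · intro h
    refine ⟨h.isCover hs hst, fun w hw hwc => ?_⟩
    obtain ⟨v, hv, hv'⟩ := hwc.exists_isotoneFamily_le hst
    have : v = u := eq_of_le_of_degree_eq (hv.trans hw) (by rw [h.degree_eq, hv'.degree_eq])
    exact le_antisymm hw (this ▸ hv)

theorem mem_hibiGens_of_degree_eq (K : Type*) [Field K] {s t : ℕ} (hs : 1 ≤ s) (hst : s + t = r + 1)
    (p : Fin n ≃ P) {u : Var r n →₀ ℕ} (hu : monomial u (1 : K) ∈ hibiIdeal K r s p)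
    (hd : u.degree = n * t) : u ∈ hibiGens K r s p := by
  rw [monomial_mem_hibiIdeal_iff] at hu
  obtain ⟨v, hv, hv'⟩ := hu.exists_isotoneFamily_le hst
  rw [mem_hibiGens_iff K hs hst, ← eq_of_le_of_degree_eq hv (by rw [hv'.degree_eq, hd])]
  exact hv'

theorem finite_hibiGens (K : Type*) [Field K] {s t : ℕ} (hs : 1 ≤ s) (hst : s + t = r + 1)
    (p : Fin n ≃ P) :
    (hibiGens K r s p).Finite := by
  refine (Set.finite_Iic (Finsupp.equivFunOnFinite.symm fun _ : Var r n => 1)).subset ?_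
  intro u hu x
  exact ((mem_hibiGens_iff K hs hst p u).1 hu).le_one x

theorem IsotoneFamily.sum_isBefore {p : Fin n ≃ P} {t : ℕ} {u : Var r n →₀ ℕ}
    (hu : IsotoneFamily p t u) (j : Fin n) (k : ℕ) :
    ∑ y with IsBefore j k y, u y = j * t + colPre u j k := by
  rw [GenHibi.sum_isBefore]
  simp only [hu.col_sum, Finset.sum_const, smul_eq_mul]
  congr 2
  have : Finset.univ.filter (fun i => i < j) = Finset.Iio j := by ext; simp
  rw [this, Fin.card_Iio]

theorem IsotoneFamily.pre_var {p : Fin n ≃ P} {t : ℕ} {u : Var r n →₀ ℕ}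
    (hu : IsotoneFamily p t u) (i : Fin r) (j : Fin n) :
    pre u (var i j) = j * t + colPre u j (i + 1) := by
  rw [GenHibi.pre_var, ← GenHibi.sum_isBefore, hu.sum_isBefore]

/-- Two families of sets of the same size are sorted column by column, because the number of letters
in each column is even. -/
theorem colPre_sortPair {p : Fin n ≃ P} {t : ℕ} {u v : Var r n →₀ ℕ} (hu : IsotoneFamily p t u)
    (hv : IsotoneFamily p t v) (j : Fin n) (k : ℕ) :
    colPre (sortPair u v).1 j k = (colPre u j k + colPre v j k + 1) / 2 ∧
    colPre (sortPair u v).2 j k = (colPre u j k + colPre v j k) / 2 := by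
  -- the case `k = 0` shows that the columns before column `j` contribute `j * t` again
  have h1 := sum_sortPair u v (IsBefore j k) fun _ _ h h' => h'.of_le h
  have h2 := sum_sortPair u v (IsBefore j 0) fun _ _ h h' => h'.of_le h
  rw [hu.sum_isBefore, hv.sum_isBefore, sum_isBefore, sum_isBefore] at h1 h2
  simp only [colPre_zero] at h2
  omega

theorem IsotoneFamily.sortPair {p : Fin n ≃ P} {t : ℕ} {u v : Var r n →₀ ℕ}
    (hu : IsotoneFamily p t u) (hv : IsotoneFamily p t v) :
    IsotoneFamily p t (sortPair u v).1 ∧ IsotoneFamily p t (sortPair u v).2 := by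
  have h := colPre_sortPair hu hv
  refine ⟨⟨fun x => ?_, fun j => ?_, fun j j' hj k => ?_⟩,
    ⟨fun x => ?_, fun j => ?_, fun j j' hj k => ?_⟩⟩
  · obtain ⟨⟨j, i⟩, rfl⟩ := toLex.surjective x
    have h1 := colPre_succ (GenHibi.sortPair u v).1 j i
    have h2 := colPre_succ u j i
    have h3 := colPre_succ v j i
    rw [(h j _).1, (h j _).1] at h1
    have h4 := hu.le_one (var i j)
    have h5 := hv.le_one (var i j)
    change (GenHibi.sortPair u v).1 (var i j) ≤ 1
    omega
  · rw [(h j r).1, hu.col_sum, hv.col_sum]; omega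
  · rw [(h j k).1, (h j' k).1]
    have h1 := hu.anti j j' hj k
    have h2 := hv.anti j j' hj k
    omega
  · obtain ⟨⟨j, i⟩, rfl⟩ := toLex.surjective x
    have h1 := colPre_succ (GenHibi.sortPair u v).2 j i
    have h2 := colPre_succ u j i
    have h3 := colPre_succ v j i
    rw [(h j _).2, (h j _).2] at h1
    have h4 := hu.le_one (var i j)
    have h5 := hv.le_one (var i j)
    change (GenHibi.sortPair u v).2 (var i j) ≤ 1
    omega
  · rw [(h j r).2, hu.col_sum, hv.col_sum]; omega
  · rw [(h j k).2, (h j' k).2]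
    have h1 := hu.anti j j' hj k
    have h2 := hv.anti j j' hj k
    omega

theorem isSortable_hibiGens (K : Type*) [Field K] {s t : ℕ} (hs : 1 ≤ s) (hst : s + t = r + 1)
    (p : Fin n ≃ P) : IsSortable (hibiGens K r s p) := by
  refine ⟨⟨n * t, fun u hu => ((mem_hibiGens_iff K hs hst p u).1 hu).degree_eq⟩,
    fun u hu v hv => ?_⟩
  rw [mem_hibiGens_iff K hs hst] at hu hv
  rw [mem_hibiGens_iff K hs hst, mem_hibiGens_iff K hs hst]
  exact hu.sortPair hv

end Families

/-! ### The toric ideal of the Rees algebra -/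

section Rees

variable {σ K : Type*} [Field K]

/-- The exponent vector in `S` and the exponent of `t` of the image in `S[t]` of a monomial in the
variables `x_a`, `y_u`. -/
def reesExp (B : Set (σ →₀ ℕ)) : (σ ⊕ B →₀ ℕ) →+ (σ →₀ ℕ) × ℕ :=
  (AddMonoidHom.prod
    (AddMonoidHom.fst (σ →₀ ℕ) (B →₀ ℕ) + (total B).comp (AddMonoidHom.snd _ _))
    ((Finsupp.degree (σ := B) (R := ℕ)).comp (AddMonoidHom.snd (σ →₀ ℕ) _))).comp
    Finsupp.sumFinsuppAddEquivProdFinsupp.toAddMonoidHom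

theorem reesExp_joinExp {B : Set (σ →₀ ℕ)} (α : σ →₀ ℕ) (c : B →₀ ℕ) :
    reesExp B (joinExp α c) = (α + total B c, c.degree) := by
  simp [reesExp, joinExp]

theorem reesExp_single_inl {B : Set (σ →₀ ℕ)} (a : σ) :
    reesExp B (Finsupp.single (Sum.inl a) 1) = (Finsupp.single a 1, 0) := by
  have : Finsupp.single (Sum.inl a) 1 = joinExp (Finsupp.single a 1) (0 : B →₀ ℕ) := by
    classical
    ext (b | b) <;> simp [Finsupp.single_apply]
  rw [this, reesExp_joinExp]
  simp

theorem reesExp_single_inr {B : Set (σ →₀ ℕ)} (u : B) :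
    reesExp B (Finsupp.single (Sum.inr u) 1) = (u.1, 1) := by
  have : Finsupp.single (Sum.inr u) 1 = joinExp (0 : σ →₀ ℕ) (Finsupp.single u 1) := by
    classical
    ext (b | b) <;> simp [Finsupp.single_apply]
  rw [this, reesExp_joinExp]
  simp

theorem joinExp_single_le {B : Set (σ →₀ ℕ)} {d : σ ⊕ B →₀ ℕ} {a : σ} {u : B}
    (ha : d (Sum.inl a) ≠ 0) (hu : d (Sum.inr u) ≠ 0) :
    joinExp (Finsupp.single a 1) (Finsupp.single u 1) ≤ d := by
  classical
  rintro (b | b)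
  · rw [joinExp_inl, Finsupp.single_apply]
    split_ifs with h
    · subst h; omega
    · omega
  · rw [joinExp_inr, Finsupp.single_apply]
    split_ifs with h
    · subst h; omega
    · omega

theorem reesExp_joinExp_single {B : Set (σ →₀ ℕ)} (a : σ) (u : B) :
    reesExp B (joinExp (Finsupp.single a 1) (Finsupp.single u 1)) =
      (Finsupp.single a 1 + u.1, 1) := by
  rw [reesExp_joinExp]; simp

theorem eq_of_single_le_single {τ : Type*} {x y : τ}
    (h : (Finsupp.single x 1 : τ →₀ ℕ) ≤ Finsupp.single y 1) : x = y :=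
  (Finsupp.single_left_inj one_ne_zero).1 (eq_of_le_of_degree_eq h (by simp))

/-- The map `reesMap`, with values in `S[t]`. -/
def reesPoly (I : Ideal (MvPolynomial σ K)) :
    MvPolynomial (σ ⊕ minGens I) K →ₐ[K] Polynomial (MvPolynomial σ K) :=
  ((reesAlgebra I).val.restrictScalars K).comp (reesMap I)

theorem mem_reesIdeal_iff {I : Ideal (MvPolynomial σ K)} {f : MvPolynomial (σ ⊕ minGens I) K} :
    f ∈ reesIdeal I ↔ reesPoly I f = 0 := by
  rw [reesIdeal, RingHom.mem_ker]
  exact (ZeroMemClass.coe_eq_zero (x := reesMap I f)).symm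

theorem reesPoly_monomial (I : Ideal (MvPolynomial σ K)) (d : σ ⊕ minGens I →₀ ℕ) :
    reesPoly I (monomial d 1) =
      Polynomial.monomial (reesExp _ d).2 (monomial (reesExp _ d).1 1) := by
  induction d using Finsupp.induction_linear with
  | zero => simp
  | add f g hf hg =>
    have hmul : (monomial (f + g) 1 : MvPolynomial (σ ⊕ minGens I) K) =
        monomial f 1 * monomial g 1 := by rw [monomial_mul, one_mul]
    rw [hmul, map_mul, hf, hg, Polynomial.monomial_mul_monomial, monomial_mul, one_mul, map_add]
    rfl
  | single x k =>
    have h1 : Finsupp.single x k = k • Finsupp.single x 1 := by simp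
    have hX : (monomial (k • Finsupp.single x 1) 1 : MvPolynomial (σ ⊕ minGens I) K) =
        X x ^ k := by rw [X, monomial_pow, one_pow]
    have hx : reesPoly I (X x) = Polynomial.monomial (reesExp _ (Finsupp.single x 1)).2
        (monomial (reesExp _ (Finsupp.single x 1)).1 1) := by
      change ((reesMap I (X x) : reesAlgebra I) : Polynomial (MvPolynomial σ K)) = _
      rw [reesMap, aeval_X]
      rcases x with a | u
      · rw [reesExp_single_inl]; rfl
      · rw [reesExp_single_inr]; rfl
    rw [h1, hX, map_pow, hx, Polynomial.monomial_pow, monomial_pow, one_pow, map_nsmul]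
    simp [mul_comm]

theorem exists_fiber_functional_reesIdeal (I : Ideal (MvPolynomial σ K)) (e : (σ →₀ ℕ) × ℕ) :
    ∃ l : MvPolynomial (σ ⊕ minGens I) K →ₗ[K] K, (∀ f ∈ reesIdeal I, l f = 0) ∧
      (∀ d, reesExp _ d = e → l (monomial d 1) = 1) ∧
      (∀ d, reesExp _ d ≠ e → l (monomial d 1) = 0) := by
  classical
  refine ⟨lcoeff K e.1 ∘ₗ ((Polynomial.lcoeff (MvPolynomial σ K) e.2).restrictScalars K) ∘ₗ
    (reesPoly I).toLinearMap, fun f hf => ?_, fun d hd => ?_, fun d hd => ?_⟩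
  · change coeff e.1 ((reesPoly I f).coeff e.2) = 0
    rw [mem_reesIdeal_iff.1 hf, Polynomial.coeff_zero, coeff_zero]
  · change coeff e.1 ((reesPoly I (monomial d 1)).coeff e.2) = 1
    rw [reesPoly_monomial, hd]
    simp
  · change coeff e.1 ((reesPoly I (monomial d 1)).coeff e.2) = 0
    rw [reesPoly_monomial, Polynomial.coeff_monomial]
    split_ifs with h
    · rw [coeff_monomial, if_neg fun h' => hd (Prod.ext h' h)]
    · simp

theorem binomial_mem_reesIdeal {I : Ideal (MvPolynomial σ K)} {d d' : σ ⊕ minGens I →₀ ℕ}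
    (h : reesExp _ d = reesExp _ d') :
    (monomial d 1 - monomial d' 1 : MvPolynomial (σ ⊕ minGens I) K) ∈ reesIdeal I := by
  rw [mem_reesIdeal_iff, map_sub, reesPoly_monomial, reesPoly_monomial, h, sub_self]

/-- If all generators have the same positive degree, then the exponent of `t` can be read off from
the degree of the exponent vector in `S`. So relations between the generators are relations of the
Rees algebra. -/
theorem rename_inr_mem_reesIdeal {I : Ideal (MvPolynomial σ K)} {d : ℕ} (hd0 : 0 < d)
    (hd : ∀ u ∈ minGens I, u.degree = d) {g : MvPolynomial (minGens I) K}
    (hg : g ∈ toricIdeal K (minGens I)) : rename Sum.inr g ∈ reesIdeal I := by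
  let Λ : MvPolynomial σ K →ₗ[K] Polynomial (MvPolynomial σ K) :=
    (basisMonomials σ K).constr K fun e => Polynomial.monomial (e.degree / d) (monomial e 1)
  have hΛ : ∀ e, Λ (monomial e 1) = Polynomial.monomial (e.degree / d) (monomial e 1) := fun e => by
    have := (basisMonomials σ K).constr_basis K
      (fun e => Polynomial.monomial (e.degree / d) (monomial e (1 : K))) e
    rwa [coe_basisMonomials] at this
  have h : Λ ∘ₗ (aeval fun u : minGens I => (monomial u.1 1 : MvPolynomial σ K)).toLinearMap =
      (reesPoly I).toLinearMap ∘ₗ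
        (rename Sum.inr : _ →ₐ[K] MvPolynomial (σ ⊕ minGens I) K).toLinearMap := by
    apply (basisMonomials (minGens I) K).ext
    intro c
    rw [coe_basisMonomials]
    change Λ (aeval _ (monomial c 1)) = reesPoly I (rename Sum.inr (monomial c 1))
    rw [aeval_monomial_eq, hΛ, rename_monomial, reesPoly_monomial, mapDomain_inr_eq_joinExp,
      reesExp_joinExp, degree_total hd, Nat.mul_div_cancel_left _ hd0, zero_add]
  rw [mem_reesIdeal_iff]
  have h' := LinearMap.congr_fun h g
  change Λ (aeval (fun u : minGens I => (monomial u.1 1 : MvPolynomial σ K)) g) = _ at h'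
  rw [toricIdeal, RingHom.mem_ker] at hg
  rw [show aeval (fun u : minGens I => (monomial u.1 1 : MvPolynomial σ K)) g = 0 from hg,
    map_zero] at h'
  exact h'.symm

variable [LinearOrder σ]

/-- Some factor `x^u` of `c` and some variable `x_a`, occurring in the image of `c` with a smaller
exponent than in the image of `c'`, allow an exchange `x_a x^u = x_b x^v` with `x_b < x_a`. -/
def ExchangeAt {B : Set (σ →₀ ℕ)} (c c' : B →₀ ℕ) : Prop :=
  ∃ a, total B c a < total B c' a ∧ ∃ u ∈ c.support, ∃ (b : σ) (v : B), a < b ∧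
    Finsupp.single a 1 + u.1 = Finsupp.single b 1 + v.1

/-- A form of the `ℓ`-exchange property: of two pairwise sorted monomials of the same degree with
different images, one allows an exchange towards the other. -/
def HasExchange (B : Set (σ →₀ ℕ)) : Prop :=
  ∀ c c' : B →₀ ℕ, PairwiseSorted c → PairwiseSorted c' → c.degree = c'.degree →
    total B c ≠ total B c' → ExchangeAt c c' ∨ ExchangeAt c' c

/-- A monomial `∏ x_a ∏ y_u` is standard if its `y`-part is pairwise sorted and no `x_a y_u` is the
larger monomial of a binomial `x_a y_u - x_b y_v` in the toric ideal of the Rees algebra. -/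
def ReesStandard {B : Set (σ →₀ ℕ)} (d : σ ⊕ B →₀ ℕ) : Prop :=
  (∃ α c, d = joinExp α c ∧ PairwiseSorted c) ∧
    ∀ (a : σ) (u : B), d (Sum.inl a) ≠ 0 → d (Sum.inr u) ≠ 0 → ∀ (b : σ) (v : B), a < b →
      Finsupp.single a 1 + u.1 ≠ Finsupp.single b 1 + v.1

variable [Fintype σ]

/-- If the images under `total` of the `y`-parts differed, an exchange would exist, and its variable
`x_a` divides the `x`-part, since the `x`-part makes up for the smaller exponent. -/
theorem ReesStandard.eq_of_reesExp_eq {B : Set (σ →₀ ℕ)} (hex : HasExchange B)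
    {d d' : σ ⊕ B →₀ ℕ} (hd : ReesStandard d) (hd' : ReesStandard d')
    (h : reesExp B d = reesExp B d') : d = d' := by
  obtain ⟨⟨α, c, rfl, hc⟩, hl⟩ := hd
  obtain ⟨⟨α', c', rfl, hc'⟩, hl'⟩ := hd'
  rw [reesExp_joinExp, reesExp_joinExp, Prod.mk.injEq] at h
  obtain ⟨h1, h2⟩ := h
  by_cases htot : total B c = total B c'
  · rw [htot] at h1
    rw [add_right_cancel h1, hc.eq_of_total_eq hc' h2 htot]
  · exfalso
    rcases hex c c' hc hc' h2 htot with
      ⟨a, ha, u, hu, b, v, hab, he⟩ | ⟨a, ha, u, hu, b, v, hab, he⟩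
    · have := DFunLike.congr_fun h1 a
      simp only [Finsupp.add_apply] at this
      refine hl a u ?_ ?_ b v hab he
      · rw [joinExp_inl]; omega
      · rw [joinExp_inr]; exact Finsupp.mem_support_iff.1 hu
    · have := DFunLike.congr_fun h1 a
      simp only [Finsupp.add_apply] at this
      refine hl' a u ?_ ?_ b v hab he
      · rw [joinExp_inl]; omega
      · rw [joinExp_inr]; exact Finsupp.mem_support_iff.1 hu

theorem single_lt_lex_single {a b : σ} (h : a < b) :
    Finsupp.single b 1 ≺[MonomialOrder.lex] Finsupp.single a 1 :=
  Finsupp.Lex.single_lt_iff.2 h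

theorem joinExp_single_lt {τ : Type*} (m : MonomialOrder τ) {a b : σ} (h : a < b) (u v : τ) :
    joinExp (Finsupp.single b 1) (Finsupp.single v 1) ≺[prodOrder MonomialOrder.lex m]
      joinExp (Finsupp.single a 1) (Finsupp.single u 1) :=
  joinExp_lt_iff.2 (Or.inl (single_lt_lex_single h))

theorem exists_lt_of_not_reesStandard {B : Set (σ →₀ ℕ)} (hB : IsSortable B)
    {m : MonomialOrder B} (hm : IsSortingOrder m) {d : σ ⊕ B →₀ ℕ} (hd : ¬ ReesStandard d) :
    ∃ d', reesExp B d' = reesExp B d ∧ d' ≺[prodOrder MonomialOrder.lex m] d := by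
  rw [ReesStandard, not_and_or] at hd
  rcases hd with hd | hd
  · obtain ⟨α, c, rfl⟩ := exists_eq_joinExp d
    have hc : ¬ PairwiseSorted c := fun h => hd ⟨α, c, rfl, h⟩
    obtain ⟨c', h1, h2, h3⟩ := exists_lt_of_not_pairwiseSorted hB hm hc
    exact ⟨joinExp α c', by rw [reesExp_joinExp, reesExp_joinExp, h1, h2],
      joinExp_lt_iff.2 (Or.inr ⟨rfl, h3⟩)⟩
  · push Not at hd
    obtain ⟨a, u, ha, hu, b, v, hab, he⟩ := hd
    obtain ⟨e, rfl⟩ := le_iff_exists_add.1 (joinExp_single_le ha hu)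
    refine ⟨joinExp (Finsupp.single b 1) (Finsupp.single v 1) + e, ?_, ?_⟩
    · rw [map_add, map_add, reesExp_joinExp_single, reesExp_joinExp_single, he]
    · rw [map_add, map_add (MonomialOrder.toSyn _) _ e]
      exact add_lt_add_left (joinExp_single_lt m hab u v) _

/-- If `x_a x^u = x_b x^v` with `x_b < x_a`, then choosing `x_b` as small as possible gives a linear
relation with initial monomial `x_a y_u`. -/
theorem exists_linearRelation {I : Ideal (MvPolynomial σ K)} {d : ℕ}
    (hd : ∀ u ∈ minGens I, u.degree = d)
    (hI : ∀ w, monomial w (1 : K) ∈ I → w.degree = d → w ∈ minGens I) {a b : σ} {u v : minGens I}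
    (hab : a < b) (he : Finsupp.single a 1 + u.1 = Finsupp.single b 1 + v.1) :
    ∃ (b' : σ) (v' : minGens I), a < b' ∧
      X (Sum.inl a) * X (Sum.inr u) - X (Sum.inl b') * X (Sum.inr v') ∈ linearRelations I := by
  obtain ⟨b', hb', hmax⟩ := Set.Finite.exists_maximal
    (s := {b' : σ | ∃ v' : minGens I, Finsupp.single a 1 + u.1 = Finsupp.single b' 1 + v'.1})
    (Set.toFinite _) ⟨b, v, he⟩
  obtain ⟨v', hv'⟩ := hb'
  have hbb' : b ≤ b' := by
    rcases le_total b b' with h | h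
    · exact h
    · exact hmax ⟨v, he⟩ h
  refine ⟨b', v', hab.trans_le hbb', a, b', u, v', hab.trans_le hbb', hv',
    fun c w hw hwI => ?_, rfl⟩
  have hdeg := congrArg Finsupp.degree hw
  simp only [map_add, Finsupp.degree_single, hd _ u.2] at hdeg
  rcases le_total c b' with h | h
  · exact h
  · exact hmax ⟨⟨w, hI w hwI (by omega)⟩, hw.symm⟩ h

/-- For a sortable set of generators with the exchange property, the Gröbner basis of the toric
ideal of the generators and the linear relations form the reduced Gröbner basis of the toric ideal
of the Rees algebra. -/
theorem isReducedGroebnerBasis_reesIdeal {I : Ideal (MvPolynomial σ K)}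
    (hfin : (minGens I).Finite) (hB : IsSortable (minGens I)) {d : ℕ} (hd0 : 0 < d)
    (hd : ∀ u ∈ minGens I, u.degree = d)
    (hI : ∀ w, monomial w (1 : K) ∈ I → w.degree = d → w ∈ minGens I)
    (hex : HasExchange (minGens I)) {m : MonomialOrder (minGens I)} (hm : IsSortingOrder m)
    {𝒢 : Set (MvPolynomial (minGens I) K)}
    (h𝒢 : IsReducedGroebnerBasis m (toricIdeal K (minGens I)) 𝒢) :
    IsReducedGroebnerBasis (prodOrder MonomialOrder.lex m) (reesIdeal I)
      (rename Sum.inr '' 𝒢 ∪ linearRelations I) := by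
  have : Finite (minGens I) := hfin
  have hspan : Ideal.span (initialMonomial m '' 𝒢) =
      Ideal.span (initialMonomial m '' sortingRelations K (minGens I)) :=
    h𝒢.span_eq.trans (isReducedGroebnerBasis_sortingRelations K hfin hB hd0 hd hm).span_eq.symm
  -- the initial ideal has quadratic generators, so no initial monomial of `𝒢` divides a variable
  have hdeg2 : ∀ g ∈ 𝒢, 2 ≤ (m.degree g).degree := by
    intro g hg
    have h1 := (monomial_mem_span_initialMonomial m).2 ⟨g, hg, le_rfl⟩
    rw [hspan] at h1
    obtain ⟨_, ⟨u, v, u', v', hu, h, rfl⟩, hle⟩ := (monomial_mem_span_initialMonomial m).1 h1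
    rw [X_mul_X_sub_eq, degree_binomial m (hm u v u' v' hu h)] at hle
    simpa using Finsupp.degree_mono hle
  have hlin : ∀ {a b : σ} (u v : minGens I), a < b →
      (prodOrder MonomialOrder.lex m).degree (X (Sum.inl a) * X (Sum.inr u) -
        X (Sum.inl b) * X (Sum.inr v) : MvPolynomial (σ ⊕ minGens I) K) =
        joinExp (Finsupp.single a 1) (Finsupp.single u 1) := fun u v hab => by
    rw [X_mul_X_eq_monomial, X_mul_X_eq_monomial, degree_binomial _ (joinExp_single_lt m hab u v)]
  have hmonic : ∀ f ∈ rename Sum.inr '' 𝒢 ∪ linearRelations I,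
      (prodOrder MonomialOrder.lex m).Monic f := by
    rintro _ (⟨g, hg, rfl⟩ | ⟨a, b, u, v, hab, -, -, rfl⟩)
    · exact monic_rename_inr _ _ (h𝒢.monic g hg)
    · rw [X_mul_X_eq_monomial, X_mul_X_eq_monomial]
      exact monic_binomial _ (joinExp_single_lt m hab u v)
  refine ⟨isGroebnerBasis_of_exists_degree_le _ ?_ ?_ ?_ ?_, hmonic, ?_⟩
  · refine (h𝒢.finite.image _).union ((Set.finite_range
      fun q : σ × σ × minGens I × minGens I =>
        (X (Sum.inl q.1) * X (Sum.inr q.2.2.1) - X (Sum.inl q.2.1) * X (Sum.inr q.2.2.2) :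
          MvPolynomial (σ ⊕ minGens I) K)).subset ?_)
    rintro _ ⟨a, b, u, v, -, -, -, rfl⟩
    exact ⟨(a, b, u, v), rfl⟩
  · rintro _ (⟨g, hg, rfl⟩ | ⟨a, b, u, v, hab, he, -, rfl⟩)
    · exact rename_inr_mem_reesIdeal hd0 hd (h𝒢.subset hg)
    · rw [X_mul_X_eq_monomial, X_mul_X_eq_monomial]
      apply binomial_mem_reesIdeal
      rw [reesExp_joinExp_single, reesExp_joinExp_single, he]
  · exact fun h0 => (hmonic 0 h0).ne_zero rfl
  · intro f hf hf0
    have hns := not_standard_degree (prodOrder MonomialOrder.lex m) (reesExp (minGens I))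
      ReesStandard (exists_fiber_functional_reesIdeal I)
      (fun _ _ h h' he => h.eq_of_reesExp_eq hex h' he)
      (fun _ h => exists_lt_of_not_reesStandard hB hm h) hf hf0
    rw [ReesStandard, not_and_or] at hns
    rcases hns with hns | hns
    · obtain ⟨α, c, hαc⟩ := exists_eq_joinExp ((prodOrder MonomialOrder.lex m).degree f)
      have hc : ¬ PairwiseSorted c := fun h => hns ⟨α, c, hαc, h⟩
      obtain ⟨g, hg, hle⟩ : ∃ g ∈ 𝒢, m.degree g ≤ c := by
        rw [← monomial_mem_span_initialMonomial, hspan, monomial_mem_span_initialMonomial]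
        exact exists_sortingRelation_degree_le K hB hm hc
      refine ⟨_, Or.inl ⟨g, hg, rfl⟩, ?_⟩
      rw [hαc, degree_rename_inr, joinExp_le_iff]
      exact ⟨zero_le, hle⟩
    · push Not at hns
      obtain ⟨a, u, ha, hu, b, v, hab, he⟩ := hns
      obtain ⟨b', v', hab', hmem⟩ := exists_linearRelation hd hI hab he
      refine ⟨_, Or.inr hmem, ?_⟩
      rw [hlin u v' hab']
      exact joinExp_single_le ha hu
  · rintro _ (⟨g, hg, rfl⟩ | ⟨a, b, u, v, hab, he, hmin, rfl⟩) _
      (⟨g', hg', rfl⟩ | ⟨a', b', u', v', hab', he', hmin', rfl⟩) hne e hmem hle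
    · classical
      rw [support_rename_of_injective Sum.inr_injective, Finset.mem_image] at hmem
      obtain ⟨c, hc, rfl⟩ := hmem
      rw [degree_rename_inr, mapDomain_inr_eq_joinExp, joinExp_le_iff] at hle
      exact h𝒢.reduced g hg g' hg' (fun h => hne (h ▸ rfl)) c hc hle.2
    · have h2 := hdeg2 g hg
      rw [X_mul_X_eq_monomial, X_mul_X_eq_monomial] at hmem
      rw [degree_rename_inr] at hle
      rcases mem_support_binomial hmem with rfl | rfl
      · have := Finsupp.degree_mono (joinExp_le_iff.1 hle).2
        simp only [Finsupp.degree_single] at this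
        omega
      · have := Finsupp.degree_mono (joinExp_le_iff.1 hle).2
        simp only [Finsupp.degree_single] at this
        omega
    · classical
      rw [support_rename_of_injective Sum.inr_injective, Finset.mem_image] at hmem
      obtain ⟨c, hc, rfl⟩ := hmem
      rw [hlin u v hab, mapDomain_inr_eq_joinExp, joinExp_le_iff] at hle
      simpa using hle.1 a
    · rw [X_mul_X_eq_monomial, X_mul_X_eq_monomial] at hmem
      rw [hlin u v hab] at hle
      rcases mem_support_binomial hmem with rfl | rfl
      -- `x_b` is determined by `x_a y_u`, because both relations use the smallest variable
      · obtain ⟨h1, h2⟩ := joinExp_le_iff.1 hle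
        obtain rfl := eq_of_single_le_single h1
        obtain rfl := eq_of_single_le_single h2
        have hb : b = b' := le_antisymm
          (hmin' b v.1 he.symm v.2.1) (hmin b' v'.1 he'.symm v'.2.1)
        subst hb
        have hv : v = v' := Subtype.ext (add_left_cancel (he.symm.trans he'))
        exact hne (by rw [hv])
      -- `x_b y_v` is not the initial monomial of a relation, by minimality of `x_b`
      · obtain ⟨h1, h2⟩ := joinExp_le_iff.1 hle
        obtain rfl := eq_of_single_le_single h1
        obtain rfl := eq_of_single_le_single h2
        exact absurd (hmin' b v.1 (he.symm.trans he'.symm) v.2.1) hab.not_ge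

end Rees

/-! ### The exchange property of generalized Hibi ideals -/

section Exchange

variable {P : Type*} [PartialOrder P] {r n : ℕ}

theorem colPre_single (i : Fin r) (j j' : Fin n) (k : ℕ) :
    colPre (Finsupp.single (var i j) 1) j' k = if j = j' ∧ i.val < k then 1 else 0 := by
  have h : ∀ i' : Fin r, (Finsupp.single (var i j) 1 : Var r n →₀ ℕ) (var i' j') =
      if i' = i then (if j = j' then 1 else 0) else 0 := fun i' => by
    rw [Finsupp.single_apply]
    by_cases h1 : i' = i <;> by_cases h2 : j = j' <;>
      simp [h1, h2, Ne.symm, Prod.ext_iff, eq_comm (a := i)]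
  rw [colPre, Finset.sum_filter]
  simp_rw [h, ← ite_and, and_comm (a := _ < k), ite_and]
  rw [Finset.sum_ite_eq']
  by_cases h1 : j = j' <;> by_cases h2 : i.val < k <;> simp [h1, h2]

/-- A column prefix that is strictly smaller in `p_j` than in all `p_{j'} < p_j` leaves room for
moving the next letter of column `j` down to place `i`. -/
theorem IsotoneFamily.exists_exchange {p : Fin n ≃ P} {t : ℕ} {u : Var r n →₀ ℕ}
    (hu : IsotoneFamily p t u) {i : Fin r} {j : Fin n} (h0 : u (var i j) = 0)
    (ht : colPre u j (i + 1) < t)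
    (hlow : ∀ j', p j' < p j → colPre u j (i + 1) < colPre u j' (i + 1)) :
    ∃ (b : Fin r) (v : Var r n →₀ ℕ), i < b ∧ IsotoneFamily p t v ∧
      Finsupp.single (var i j) 1 + u = Finsupp.single (var b j) 1 + v := by
  classical
  -- the next letter of column `j` after place `i` is at place `b`
  have hex : ∃ q, colPre u j (i + 1) < colPre u j q := ⟨r, by rwa [hu.col_sum]⟩
  obtain ⟨b, hb⟩ : ∃ b, Nat.find hex = b + 1 := Nat.exists_eq_succ_of_ne_zero fun h => by
    have := Nat.find_spec hex
    rw [h] at this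
    simp at this
  have hb1 := Nat.find_spec hex
  rw [hb] at hb1
  have hb2 : colPre u j b ≤ colPre u j (i + 1) := not_lt.1 (Nat.find_min hex (by omega))
  have hbr : b < r := by
    by_contra! hcon
    rw [colPre_of_le u j hcon] at hb2
    rw [colPre_of_le u j (hcon.trans b.le_succ)] at hb1
    omega
  have hib : (i : ℕ) < b := by
    by_contra! hcon
    have := colPre_mono u j (show b + 1 ≤ i + 1 by omega)
    omega
  have hub : 1 ≤ u (var ⟨b, hbr⟩ j) := by
    have := colPre_succ u j ⟨b, hbr⟩
    simp only at this
    omega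
  have hle : Finsupp.single (var ⟨b, hbr⟩ j) 1 ≤ Finsupp.single (var i j) 1 + u := by
    intro x
    rw [Finsupp.single_apply]
    split_ifs with hx
    · subst hx
      exact hub.trans (by simp)
    · omega
  obtain ⟨v, hv⟩ := le_iff_exists_add.1 hle
  have hcol : ∀ j' k, (if j = j' ∧ i.val < k then 1 else 0) + colPre u j' k =
      (if j = j' ∧ b < k then 1 else 0) + colPre v j' k := fun j' k => by
    have := congrArg (fun w => colPre w j' k) hv
    simpa only [colPre_add, colPre_single] using this
  have hother : ∀ j' k, j ≠ j' → colPre v j' k = colPre u j' k := fun j' k h => by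
    have := hcol j' k
    simp only [h, false_and, if_false] at this
    omega
  have hsame : ∀ k, (if i.val < k then 1 else 0) + colPre u j k =
      (if b < k then 1 else 0) + colPre v j k := fun k => by
    simpa using hcol j k
  refine ⟨⟨b, hbr⟩, v, hib, ⟨fun x => ?_, fun j' => ?_, fun j₁ j₂ h k => ?_⟩, hv⟩
  · have h1 := DFunLike.congr_fun hv x
    simp only [Finsupp.add_apply] at h1
    have h2 := hu.le_one x
    by_cases hx : var i j = x
    · subst hx
      rw [h0, Finsupp.single_eq_same] at h1
      omega
    · rw [Finsupp.single_eq_of_ne (Ne.symm hx)] at h1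
      omega
  · by_cases hj : j = j'
    · subst hj
      have := hsame r
      rw [if_pos i.2, if_pos hbr, hu.col_sum] at this
      omega
    · rw [hother j' r hj, hu.col_sum]
  · have hanti := hu.anti j₁ j₂ h k
    by_cases h1 : j = j₁ <;> by_cases h2 : j = j₂
    · rw [← h1, ← h2]
    · subst h1
      rw [hother j₂ k h2]
      have := hsame k
      split_ifs at this <;> omega
    · subst h2
      rw [hother j₁ k h1]
      have hlt : p j₁ < p j := lt_of_le_of_ne h fun he => h1 (p.injective he).symm
      have h3 := hlow j₁ hlt
      have h4 := hsame k
      by_cases hik : i.val < k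
      · by_cases hbk : b < k
        · rw [if_pos hik, if_pos hbk] at h4
          omega
        -- the prefix grows by one, but it is the same as at place `i`, where there is room
        · have h5 := colPre_mono u j (show k ≤ b by omega)
          have h6 := colPre_mono u j₁ (show (i : ℕ) + 1 ≤ k by omega)
          rw [if_pos hik, if_neg hbk] at h4
          omega
      · rw [if_neg hik, if_neg (by omega)] at h4
        omega
    · rw [hother j₁ k h1, hother j₂ k h2]
      exact hanti

variable {p : Fin n ≃ P} {t : ℕ} {B : Set (Var r n →₀ ℕ)}

theorem colPre_total (hB : ∀ u ∈ B, IsotoneFamily p t u) (c : B →₀ ℕ) (j : Fin n) :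
    colPre (total B c) j r = c.degree * t := by
  induction c using Finsupp.induction_linear with
  | zero => simp [colPre]
  | add f g hf hg => rw [map_add, colPre_add, hf, hg, map_add, add_mul]
  | single u k =>
    have h1 : Finsupp.single u k = k • Finsupp.single u 1 := by simp
    have h2 : ∀ k : ℕ, colPre (k • u.1) j r = k * t := fun k => by
      induction k with
      | zero => simp [colPre]
      | succ k ih => rw [succ_nsmul, colPre_add, ih, (hB _ u.2).col_sum]; ring
    rw [h1, map_nsmul, total_single, h2]
    simp

theorem pre_total (hB : ∀ u ∈ B, IsotoneFamily p t u) (c : B →₀ ℕ) (i : Fin r) (j : Fin n) :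
    pre (total B c) (var i j) =
      (∑ _j' : Fin n with _j' < j, c.degree * t) + colPre (total B c) j (i + 1) := by
  rw [pre_var]
  simp only [colPre_total hB]

/-- Column prefixes of the factors of pairwise sorted monomials compare as those of the products. -/
theorem colPre_getElem_le (hB : ∀ u ∈ B, IsotoneFamily p t u) {c c' : B →₀ ℕ} {l l' : List B}
    (hl : Finsupp.toMultiset c = l) (hp : l.Pairwise fun u v => Interlaced u.1 v.1)
    (hl' : Finsupp.toMultiset c' = l') (hp' : l'.Pairwise fun u v => Interlaced u.1 v.1)
    (hdeg : c.degree = c'.degree) {a : ℕ} (ha : a < l.length) (ha' : a < l'.length)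
    {j : Fin n} {k : ℕ} (hk : k ≤ r) (h : colPre (total B c) j k ≤ colPre (total B c') j k) :
    colPre l[a].1 j k ≤ colPre l'[a].1 j k := by
  cases k with
  | zero => simp
  | succ k =>
    have hlen : l.length = l'.length := by
      rw [length_of_toMultiset_eq hl, length_of_toMultiset_eq hl', hdeg]
    have h1 := pre_total hB c ⟨k, hk⟩ j
    have h2 := pre_total hB c' ⟨k, hk⟩ j
    rw [← hdeg] at h2
    have h3 : pre l[a].1 (var ⟨k, hk⟩ j) ≤ pre l'[a].1 (var ⟨k, hk⟩ j) := by
      rw [pre_getElem_of_pairwise_interlaced hl hp, pre_getElem_of_pairwise_interlaced hl' hp',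
        hlen]
      apply Nat.div_le_div_right
      simp only at h1 h2
      omega
    rw [(hB _ l[a].2).pre_var, (hB _ l'[a].2).pre_var] at h3
    simp only at h3
    omega

/-- The exchange takes place in a column `j` whose prefixes differ while those of all columns `j'`
with `p_{j'} < p_j` agree, at the first place where the prefix of `c` is smaller. In the `a`-th
factors of `c` and `c'` the prefixes compare in the same way, for a suitable `a`. -/
theorem exchangeAt_of_colPre_lt (hB : ∀ u, u ∈ B ↔ IsotoneFamily p t u) {c c' : B →₀ ℕ}
    (hc : PairwiseSorted c) (hc' : PairwiseSorted c') (hdeg : c.degree = c'.degree) {j : Fin n}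
    (hlow : ∀ j', p j' < p j → ∀ k, colPre (total B c) j' k = colPre (total B c') j' k)
    (hlt : ∃ k, colPre (total B c) j k < colPre (total B c') j k) : ExchangeAt c c' := by
  classical
  have hB' : ∀ u ∈ B, IsotoneFamily p t u := fun u hu => (hB u).1 hu
  obtain ⟨i, hi⟩ : ∃ i, Nat.find hlt = i + 1 := Nat.exists_eq_succ_of_ne_zero fun h => by
    have := Nat.find_spec hlt
    rw [h] at this
    simp at this
  have h1 := Nat.find_spec hlt
  rw [hi] at h1
  have h2 : colPre (total B c') j i ≤ colPre (total B c) j i :=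
    not_lt.1 (Nat.find_min hlt (by omega))
  have hir : i < r := by
    by_contra! hcon
    rw [colPre_of_le _ _ hcon, colPre_of_le _ _ hcon] at h2
    rw [colPre_of_le _ _ (hcon.trans i.le_succ), colPre_of_le _ _ (hcon.trans i.le_succ)] at h1
    omega
  obtain ⟨l, hl, hp⟩ := hc.exists_list
  obtain ⟨l', hl', hp'⟩ := hc'.exists_list
  have hlen : l.length = l'.length := by
    rw [length_of_toMultiset_eq hl, length_of_toMultiset_eq hl', hdeg]
  obtain ⟨a, ha, ha', hUV⟩ : ∃ (a : ℕ) (ha : a < l.length) (ha' : a < l'.length),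
      colPre l[a].1 j (i + 1) < colPre l'[a].1 j (i + 1) := by
    by_contra! hcon
    have h3 := pre_total hB' c ⟨i, hir⟩ j
    have h4 := pre_total hB' c' ⟨i, hir⟩ j
    rw [← hdeg] at h4
    rw [← sum_pre_getElem hl] at h3
    rw [← sum_pre_getElem hl'] at h4
    have h5 : ∑ a : Fin l'.length, pre l'[a].1 (var ⟨i, hir⟩ j) ≤
        ∑ a : Fin l.length, pre l[a].1 (var ⟨i, hir⟩ j) := by
      rw [← Equiv.sum_comp (finCongr hlen)]
      refine Finset.sum_le_sum fun a _ => ?_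
      have h6 := hcon a a.2 (hlen ▸ a.2)
      change pre l'[(a : ℕ)].1 _ ≤ pre l[(a : ℕ)].1 _
      rw [(hB' _ l[(a : ℕ)].2).pre_var, (hB' _ l'[(a : ℕ)].2).pre_var]
      simp only
      omega
    simp only at h3 h4
    omega
  have hU := hB' _ l[a].2
  have hV := hB' _ l'[a].2
  have h3 : colPre l'[a].1 j i ≤ colPre l[a].1 j i :=
    colPre_getElem_le hB' hl' hp' hl hp hdeg.symm ha' ha hir.le h2
  have h4 := colPre_succ l[a].1 j ⟨i, hir⟩
  have h5 := colPre_succ l'[a].1 j ⟨i, hir⟩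
  have h6 := hV.le_one (var ⟨i, hir⟩ j)
  have h7 : colPre l'[a].1 j (i + 1) ≤ t := by
    rw [← hV.col_sum j]
    exact colPre_mono _ _ hir
  simp only at h4 h5
  obtain ⟨b, v, hib, hv, he⟩ := hU.exists_exchange (i := ⟨i, hir⟩) (j := j) (by omega)
    (lt_of_lt_of_le hUV h7) fun j' hj' => by
      have h8 := hV.anti j' j hj'.le (i + 1)
      have h9 := colPre_getElem_le hB' hl' hp' hl hp hdeg.symm ha' ha hir (hlow j' hj' (i + 1)).ge
      exact lt_of_lt_of_le hUV (h8.trans h9)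
  refine ⟨var ⟨i, hir⟩ j, ?_, l[a], ?_, var b j, ⟨v, (hB v).2 hv⟩, ?_, he⟩
  · have h8 := colPre_succ (total B c) j ⟨i, hir⟩
    have h9 := colPre_succ (total B c') j ⟨i, hir⟩
    simp only at h8 h9
    omega
  · rw [← Finsupp.mem_toMultiset, hl]
    exact List.getElem_mem ha
  · exact Prod.Lex.toLex_lt_toLex.2 (Or.inr ⟨rfl, hib⟩)

theorem hasExchange_of_isotoneFamily (hB : ∀ u, u ∈ B ↔ IsotoneFamily p t u) : HasExchange B := by
  classical
  intro c c' hc hc' hdeg hne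
  obtain ⟨j₀, hj₀⟩ : ∃ j, ∃ k, colPre (total B c) j k ≠ colPre (total B c') j k := by
    by_contra! hcon
    exact hne (eq_of_colPre_eq hcon)
  obtain ⟨j, hj, hmin⟩ := Finset.exists_minimalFor p
    (Finset.univ.filter fun j => ∃ k, colPre (total B c) j k ≠ colPre (total B c') j k)
    ⟨j₀, by simpa using hj₀⟩
  have hlow : ∀ j', p j' < p j → ∀ k, colPre (total B c) j' k = colPre (total B c') j' k := by
    intro j' hj'
    by_contra! hcon
    exact hj'.not_ge (hmin (by simpa using hcon) hj'.le)
  obtain ⟨k, hk⟩ : ∃ k, colPre (total B c) j k ≠ colPre (total B c') j k := by simpa using hj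
  rcases lt_or_gt_of_ne hk with h | h
  · exact Or.inl (exchangeAt_of_colPre_lt hB hc hc' hdeg hlow ⟨k, h⟩)
  · exact Or.inr (exchangeAt_of_colPre_lt hB hc' hc hdeg.symm
      (fun j' hj' k => (hlow j' hj' k).symm) ⟨k, h⟩)

end Exchange

end
end GenHibi

theorem mainTheorem11 {P : Type*} [PartialOrder P] [Nonempty P] (K : Type*) [Field K]
    (r s n : ℕ) (hs : 1 ≤ s) (hsr : s ≤ r) (p : Fin n ≃ P) :
    GenHibi.IsSortable (GenHibi.hibiGens K r s p) ∧
    (∃ m : MonomialOrder.{0, 0} (GenHibi.hibiGens K r s p), GenHibi.IsSortingOrder m) ∧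
    ∀ m : MonomialOrder.{0, w} (GenHibi.hibiGens K r s p), GenHibi.IsSortingOrder m →
      GenHibi.IsReducedGroebnerBasis m (GenHibi.toricIdeal K (GenHibi.hibiGens K r s p))
        (GenHibi.sortingRelations K (GenHibi.hibiGens K r s p)) ∧
      ∀ 𝒢 : Set (MvPolynomial (GenHibi.hibiGens K r s p) K),
        GenHibi.IsReducedGroebnerBasis m (GenHibi.toricIdeal K (GenHibi.hibiGens K r s p)) 𝒢 →
        GenHibi.IsReducedGroebnerBasis (GenHibi.lexSharp m)
          (GenHibi.reesIdeal (GenHibi.hibiIdeal K r s p))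
          (MvPolynomial.rename Sum.inr '' 𝒢 ∪
            GenHibi.linearRelations (GenHibi.hibiIdeal K r s p)) := by
  obtain ⟨t, hst⟩ : ∃ t, s + t = r + 1 := ⟨r + 1 - s, by omega⟩
  have hmem := GenHibi.mem_hibiGens_iff K hs hst p
  have hfin := GenHibi.finite_hibiGens K hs hst p
  have hsort := GenHibi.isSortable_hibiGens K hs hst p
  have hdeg : ∀ u ∈ GenHibi.hibiGens K r s p, u.degree = n * t := fun u hu =>
    ((hmem u).1 hu).degree_eq
  have hpos : 0 < n * t := by
    obtain ⟨x⟩ := ‹Nonempty P›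
    have := (p.symm x).pos
    exact Nat.mul_pos this (by omega)
  refine ⟨hsort, GenHibi.exists_isSortingOrder hfin, fun m hm => ⟨?_, fun 𝒢 h𝒢 => ?_⟩⟩
  · exact GenHibi.isReducedGroebnerBasis_sortingRelations K hfin hsort hpos hdeg hm
  · exact GenHibi.isReducedGroebnerBasis_reesIdeal hfin hsort hpos hdeg
      (fun u hu hd => GenHibi.mem_hibiGens_of_degree_eq K hs hst p hu hd)
      (GenHibi.hasExchange_of_isotoneFamily hmem) hm h𝒢
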